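/- An instance of Steiner Orientation is a pair $(G,\mathcal T)$, where $G=(V,E,A)$ is a finite loopless mixed graph with set of undirected edges $E$ and set of arcs $A$, and $\mathcal T\subseteq V\times V$ is a set of $k$ terminal pairs $(s,t)$ with $s\ne t$. It is a yes-instance if the edges in $E$ can be oriented so that the resulting directed graph contains a directed path from $s$ to $t$ for every $(s,t)\in\mathcal T$. Let $\mathrm{vc}$ denote the vertex cover number of the underlying graph of $G$ (every arc is replaced by an edge with the same endpoints). Theorem. Steiner Orientation admits a kernel of order $O(\mathrm{vc}^2+k)$. That is, there are a constant $C$ and a polynomial-time algorithm that transforms every instance $(G,\mathcal T)$ into an instance $(G',\mathcal T')$ such that $(G,\mathcal T)$ is a yes-instance if and only if $(G',\mathcal T')$ is one, $G'$ has at most $C(\mathrm{vc}^2+k)$ vertices, and $|\mathcal T'|\le k$. -/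

import Mathlib

namespace SteinerOrientation

/-! ### Mixed graphs and orientations -/

/-- A mixed graph on the vertex set `V`: undirected edges `E` and directed arcs `A`, neither of
which may be loops. An edge and an arc, or two opposite arcs, may join the same two vertices. -/
structure MixedGraph (V : Type*) where
  E : SimpleGraph V
  A : Digraph V
  loopless : ∀ v, ¬ A.Adj v v

/-- The underlying graph: every arc is replaced by an edge with the same endpoints. -/
def MixedGraph.underlying {V : Type*} (G : MixedGraph V) : SimpleGraph V where
  Adj u v := G.E.Adj u v ∨ G.A.Adj u v ∨ G.A.Adj v u
  symm := ⟨fun _ _ h => h.elim (fun e => Or.inl e.symm) (fun a => Or.inr a.symm)⟩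
  loopless := ⟨fun v h => h.elim (fun e => e.ne rfl) (fun a => a.elim (G.loopless v) (G.loopless v))⟩

/-- `D` is an orientation of the edges of `E`: it consists of exactly one of the two arcs
`(u, v)`, `(v, u)` for each edge `{u, v}`, and of nothing else. -/
structure IsOrientation {V : Type*} (E : SimpleGraph V) (D : Digraph V) : Prop where
  adj_of_arc : ∀ u v, D.Adj u v → E.Adj u v
  exactly_one : ∀ u v, E.Adj u v → Xor (D.Adj u v) (D.Adj v u)

/-- The digraph obtained from `G` by replacing its edges by the arcs of the orientation `D`. -/
def MixedGraph.orient {V : Type*} (G : MixedGraph V) (D : Digraph V) : Digraph V where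
  Adj u v := G.A.Adj u v ∨ D.Adj u v

/-- There is a directed path from `s` to `t` in `D`. -/
def HasDirectedPath {V : Type*} (D : Digraph V) (s t : V) : Prop :=
  Relation.ReflTransGen D.Adj s t

/-! ### The problem -/

/-- An instance of Steiner Orientation: a mixed graph on `n` vertices and a set of terminal
pairs `(s, t)` with `s ≠ t`. -/
structure Instance where
  n : ℕ
  G : MixedGraph (Fin n)
  T : Finset (Fin n × Fin n)
  ne_of_mem : ∀ p ∈ T, p.1 ≠ p.2

namespace Instance

/-- The yes-instances: some orientation of the edges contains, for every terminal pair `(s, t)`,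
a directed path from `s` to `t`. -/
def IsYes (I : Instance) : Prop :=
  ∃ D : Digraph (Fin I.n), IsOrientation I.G.E D ∧
    ∀ p ∈ I.T, HasDirectedPath (I.G.orient D) p.1 p.2

/-- The number of terminal pairs. -/
def k (I : Instance) : ℕ := I.T.card

/-- The vertex cover number of the underlying graph. -/
noncomputable def vc (I : Instance) : ℕ := I.G.underlying.vertexCoverNum.toNat

theorem coe_vc (I : Instance) : (I.vc : ℕ∞) = I.G.underlying.vertexCoverNum := by
  refine ENat.natCast_toNat fun h => ?_
  obtain ⟨s, hs, -⟩ := SimpleGraph.vertexCoverNum_exists I.G.underlying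
  exact (Set.toFinite s).encard_lt_top.ne (hs.trans h)

end Instance

/-! ### Polynomial-time computation

The machine is a random-access machine, programmed by while-programs. Its memory consists of
arrays with two indices, of which a program mentions finitely many; a scalar is a cell of an array.
Cells hold natural numbers. The arithmetic operations are addition and truncated subtraction only,
so that in `t` steps the length of the numbers in binary grows by `O(t)` at most: with unit cost
per executed instruction, this machine and a Turing machine simulate each other with a polynomial
overhead. -/

/-- The memory: `σ a i j` is the content of the cell `(i, j)` of the array `a`. -/
abbrev Memory := ℕ → ℕ → ℕ → ℕ

/-- Expressions. The name `a` of the array in `get a i j` is a constant, its indices are computed. -/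
inductive Expr where
  | const (c : ℕ)
  | get (a : ℕ) (i j : Expr)
  | add (x y : Expr)
  | sub (x y : Expr)

/-- The value of an expression; `x - y` is `0` if `x ≤ y`. -/
def Expr.eval (σ : Memory) : Expr → ℕ
  | .const c => c
  | .get a i j => σ a (i.eval σ) (j.eval σ)
  | .add x y => x.eval σ + y.eval σ
  | .sub x y => x.eval σ - y.eval σ

/-- Writing the value `x` into the cell `(i, j)` of the array `a`. -/
def Memory.write (σ : Memory) (a i j x : ℕ) : Memory :=
  fun a' i' j' => if a' = a ∧ i' = i ∧ j' = j then x else σ a' i' j'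

/-- Programs; a test succeeds if the value of the expression is not `0`. -/
inductive Program where
  | skip
  | assign (a : ℕ) (i j x : Expr)
  | seq (P Q : Program)
  | ite (b : Expr) (P Q : Program)
  | loop (b : Expr) (P : Program)

/-- `Exec P σ t τ`: started in the memory `σ`, the program `P` halts in the memory `τ` after
exactly `t` steps. Each assignment, each `skip` and each evaluation of a test is one step (the
expressions of a fixed program have bounded size). -/
inductive Exec : Program → Memory → ℕ → Memory → Prop where
  | skip (σ : Memory) : Exec .skip σ 1 σ
  | assign (a : ℕ) (i j x : Expr) (σ : Memory) :
      Exec (.assign a i j x) σ 1 (σ.write a (i.eval σ) (j.eval σ) (x.eval σ))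
  | seq {P Q : Program} {σ τ ρ : Memory} {t u : ℕ} :
      Exec P σ t τ → Exec Q τ u ρ → Exec (.seq P Q) σ (t + u) ρ
  | ite_true {b : Expr} {P Q : Program} {σ τ : Memory} {t : ℕ} :
      b.eval σ ≠ 0 → Exec P σ t τ → Exec (.ite b P Q) σ (t + 1) τ
  | ite_false {b : Expr} {P Q : Program} {σ τ : Memory} {t : ℕ} :
      b.eval σ = 0 → Exec Q σ t τ → Exec (.ite b P Q) σ (t + 1) τ
  | loop_true {b : Expr} {P : Program} {σ τ ρ : Memory} {t u : ℕ} :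
      b.eval σ ≠ 0 → Exec P σ t τ → Exec (.loop b P) τ u ρ → Exec (.loop b P) σ (t + u + 1) ρ
  | loop_false {b : Expr} {P : Program} {σ : Memory} :
      b.eval σ = 0 → Exec (.loop b P) σ 1 σ

open Classical in
/-- The encoding of an instance: the cell `(0, 0)` of the array `0` holds the number of vertices,
the arrays `1`, `2`, `3` hold the adjacency matrices of the edges, the arcs and the terminal pairs,
and every other cell is `0`. -/
noncomputable def Instance.encode (I : Instance) : Memory := fun a i j =>
  if a = 0 ∧ i = 0 ∧ j = 0 then I.n
  else if a = 1 ∧ (∃ u v : Fin I.n, u = i ∧ v = j ∧ I.G.E.Adj u v) then 1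
  else if a = 2 ∧ (∃ u v : Fin I.n, u = i ∧ v = j ∧ I.G.A.Adj u v) then 1
  else if a = 3 ∧ (∃ u v : Fin I.n, u = i ∧ v = j ∧ (u, v) ∈ I.T) then 1
  else 0

/-- The instance `I` can be read off from the memory `σ`: the number of vertices and the entries of
the three matrices are as in the encoding of `I`. The other cells may hold anything. -/
def Represents (σ : Memory) (I : Instance) : Prop :=
  σ 0 0 0 = I.n ∧
    ∀ a ∈ ({1, 2, 3} : Set ℕ), ∀ i < I.n, ∀ j < I.n, σ a i j = I.encode a i j

/-- `f` is computed in polynomial time. The length of the encoding of an instance `I` is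
polynomially bounded in `I.n` and at least `I.n`, so that `I.n` may serve as the input size. -/
def PolyTimeComputable (f : Instance → Instance) : Prop :=
  ∃ (P : Program) (p : Polynomial ℕ), ∀ I : Instance,
    ∃ (t : ℕ) (σ : Memory), t ≤ p.eval I.n ∧ Exec P I.encode t σ ∧ Represents σ (f I)

end SteinerOrientation

/-! Let `X` be a greedy vertex cover, of size at most twice the optimum. Vertices of `X` and
terminals are fixed. The other, free vertices are independent with all neighbours in `X`, so a path
uses a free vertex `w` only to pass from some `x` to some `y` in `X`: what `w` offers is a set of
pairs `(x, y)`. Free vertices are matched to pairs that they provide, and the kernel is induced by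
the fixed and the matched vertices, at most `2 vc + 2 k + (2 vc) ^ 2` in number.

A solution of the kernel extends to the whole graph (`isYes_of_comap`). For the converse, one wants
a set `R` of free vertices that contains all deleted ones and in which every pair provided by a
member is held by a kept member of its own. Orienting each kept member of `R` along its pair then
lets every passage of a path through `R` be rerouted, even if one vertex of `R` served many pairs in
the old solution (`isYes_comap`).

The set `R` is read off from prices. In the auction, an unmatched vertex takes a cheapest pair it
provides, evicts the holder and raises the price by one, until unmatched vertices see only prices of
at least `n ^ 2 + 1`. There are only `n ^ 2` pairs, so some price `j` between `1` and `n ^ 2 + 1`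
does not occur, and `R` consists of the free vertices that are unmatched or hold a pair of price
above `j` (`exists_gap`). Each bid raises the sum of the prices, which is bounded, so polynomially
many rounds suffice (`Bidding.settled`). -/

namespace SteinerOrientation

/-! ### Correctness and running time of programs -/

/-- Started in `σ`, the program `c` halts within `T` steps in a memory satisfying `Q`. -/
def Runs (c : Program) (σ : Memory) (T : ℕ) (Q : Memory → Prop) : Prop :=
  ∃ t τ, t ≤ T ∧ Exec c σ t τ ∧ Q τ

theorem Runs.mono {c : Program} {σ : Memory} {T T' : ℕ} {Q Q' : Memory → Prop}
    (h : Runs c σ T Q) (hT : T ≤ T') (hQ : ∀ τ, Q τ → Q' τ) : Runs c σ T' Q' := by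
  obtain ⟨t, τ, ht, he, hq⟩ := h
  exact ⟨t, τ, ht.trans hT, he, hQ τ hq⟩

theorem Runs.assign {a : ℕ} {i j x : Expr} {σ : Memory} {Q : Memory → Prop}
    (h : Q (σ.write a (i.eval σ) (j.eval σ) (x.eval σ))) : Runs (.assign a i j x) σ 1 Q :=
  ⟨1, _, le_rfl, .assign a i j x σ, h⟩

theorem Runs.seq {c d : Program} {σ : Memory} {T U : ℕ} {Q : Memory → Prop}
    (h : Runs c σ T fun τ => Runs d τ U Q) : Runs (.seq c d) σ (T + U) Q := by
  obtain ⟨t, τ, ht, he, u, ρ, hu, he', hq⟩ := h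
  exact ⟨t + u, ρ, add_le_add ht hu, .seq he he', hq⟩

/-- Run `c` if the test `b` succeeds. -/
def Program.when (b : Expr) (c : Program) : Program := .ite b c .skip

theorem Runs.when {b : Expr} {c : Program} {σ : Memory} {T : ℕ} {Q : Memory → Prop}
    (h : b.eval σ ≠ 0 → Runs c σ T Q) (h' : b.eval σ = 0 → Q σ) :
    Runs (.when b c) σ (T + 2) Q := by
  by_cases hb : b.eval σ = 0
  · exact ⟨1 + 1, σ, by omega, .ite_false hb (.skip σ), h' hb⟩
  · obtain ⟨t, τ, ht, he, hq⟩ := h hb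
    exact ⟨t + 1, τ, by omega, .ite_true hb he, hq⟩

/-- The scalar stored in the array `a`. -/
abbrev Expr.var (a : ℕ) : Expr := .get a (.const 0) (.const 0)

/-- Run `c` with the scalar `a` counting from `0` up to, and excluding, the value of `e`. -/
def Program.for (a : ℕ) (e : Expr) (c : Program) : Program :=
  .seq (.assign a (.const 0) (.const 0) (.const 0))
    (.loop (.sub e (.var a))
      (.seq c (.assign a (.const 0) (.const 0) (.add (.var a) (.const 1)))))

/-- Overwriting an entry of an array. -/
def upd (f : ℕ → ℕ → ℕ) (i j x : ℕ) : ℕ → ℕ → ℕ :=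
  fun i' j' => if i' = i ∧ j' = j then x else f i' j'

theorem upd_apply (f : ℕ → ℕ → ℕ) (i j x i' j' : ℕ) :
    upd f i j x i' j' = if i' = i ∧ j' = j then x else f i' j' := rfl

@[simp] theorem upd_self (f : ℕ → ℕ → ℕ) (i j x : ℕ) : upd f i j x i j = x := by simp [upd]

@[simp] theorem write_self (σ : Memory) (a i j x : ℕ) : σ.write a i j x a = upd (σ a) i j x := by
  funext i' j'
  simp [Memory.write, upd]

@[simp] theorem write_of_ne (σ : Memory) {a b : ℕ} (i j x : ℕ) (h : b ≠ a) :
    σ.write a i j x b = σ b := by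
  funext i' j'
  simp [Memory.write, h]

/-- The bound `e` is evaluated anew at each test, hence `bound`. By `stable` the invariant ignores
the counter, whose value is tracked separately. Each round costs two steps besides the body, the
test and the increment; the final `+ 2` is the initialization and the failing test. -/
theorem Runs.for {a : ℕ} {e : Expr} {c : Program} {σ : Memory} {N T : ℕ}
    (Inv : ℕ → Memory → Prop)
    (bound : ∀ i τ, Inv i τ → e.eval τ = N)
    (stable : ∀ i τ x, Inv i τ → Inv i (τ.write a 0 0 x))
    (init : Inv 0 σ)
    (step : ∀ i < N, ∀ τ, Inv i τ → τ a 0 0 = i →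
      Runs c τ T fun ρ => ρ a 0 0 = i ∧ Inv (i + 1) ρ) :
    Runs (.for a e c) σ (N * (T + 2) + 2) (Inv N) := by
  have key : ∀ d i, i + d = N → ∀ τ, Inv i τ → τ a 0 0 = i →
      Runs (.loop (.sub e (.var a))
        (.seq c (.assign a (.const 0) (.const 0) (.add (.var a) (.const 1))))) τ
        (d * (T + 2) + 1) (Inv N) := by
    intro d
    induction d with
    | zero =>
      intro i hi τ hτ ha
      refine ⟨1, τ, by omega, .loop_false ?_, by simpa [← hi] using hτ⟩
      simp [Expr.eval, bound i τ hτ, ha, ← hi]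
    | succ d ih =>
      intro i hi τ hτ ha
      obtain ⟨t, ρ, ht, he, hρ, hI⟩ := step i (by omega) τ hτ ha
      obtain ⟨u, π, hu, he', hπ⟩ := ih (i + 1) (by omega) (ρ.write a 0 0 (ρ a 0 0 + 1))
        (stable _ _ _ hI) (by simp [hρ])
      refine ⟨t + 1 + u + 1, π, ?_, .loop_true ?_ (.seq he (.assign a _ _ _ ρ)) he', hπ⟩
      · rw [add_mul]
        omega
      · simp [Expr.eval, bound i τ hτ, ha]
        omega
  refine (Runs.seq (Runs.assign (key N 0 (by simp) _ (stable _ _ _ init) ?_))).mono (by omega)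
    fun _ h => h
  simp [Expr.eval]

/-! ### Induced subinstances -/

/-- The mixed graph induced on the image of `ι`. -/
def MixedGraph.comap {V W : Type*} (G : MixedGraph V) (ι : W ↪ V) : MixedGraph W where
  E := G.E.comap ι
  A := { Adj := fun i j => G.A.Adj (ι i) (ι j) }
  loopless := fun v => G.loopless (ι v)

open Classical in
/-- The instance induced on the image of `ι`. -/
noncomputable def Instance.comap (I : Instance) {m : ℕ} (ι : Fin m ↪ Fin I.n) : Instance where
  n := m
  G := I.G.comap ι
  T := Finset.univ.filter fun p => (ι p.1, ι p.2) ∈ I.T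
  ne_of_mem := fun _ hp h => I.ne_of_mem _ (Finset.mem_filter.1 hp).2 (congrArg ι h)

theorem Instance.mem_comap (I : Instance) {m : ℕ} (ι : Fin m ↪ Fin I.n) (p : Fin m × Fin m) :
    p ∈ (I.comap ι).T ↔ (ι p.1, ι p.2) ∈ I.T :=
  Finset.mem_filter.trans (and_iff_right (Finset.mem_univ _))

theorem Instance.k_comap_le (I : Instance) {m : ℕ} (ι : Fin m ↪ Fin I.n) :
    (I.comap ι).k ≤ I.k := by
  refine Finset.card_le_card_of_injOn (fun p => (ι p.1, ι p.2)) ?_ ?_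
  · intro p hp
    exact (I.mem_comap ι p).1 hp
  · rintro ⟨a, b⟩ - ⟨c, d⟩ - h
    exact Prod.ext (ι.injective (congrArg Prod.fst h)) (ι.injective (congrArg Prod.snd h))

/-- Edges with a deleted end may be oriented arbitrarily, here from the smaller to the larger index;
paths of the subinstance survive. -/
theorem Instance.isYes_of_comap (I : Instance) {m : ℕ} (ι : Fin m ↪ Fin I.n)
    (hT : ∀ p ∈ I.T, p.1 ∈ Set.range ι ∧ p.2 ∈ Set.range ι) (h : (I.comap ι).IsYes) :
    I.IsYes := by
  obtain ⟨D, hD, hp⟩ := h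
  refine ⟨{ Adj := fun u v => I.G.E.Adj u v ∧ ((∃ i j, ι i = u ∧ ι j = v ∧ D.Adj i j) ∨
    (¬ (u ∈ Set.range ι ∧ v ∈ Set.range ι) ∧ u < v)) }, ⟨fun u v h => h.1, ?_⟩, ?_⟩
  · intro u v huv
    by_cases hr : u ∈ Set.range ι ∧ v ∈ Set.range ι
    · obtain ⟨⟨i, rfl⟩, ⟨j, rfl⟩⟩ := hr
      have := hD.exactly_one i j huv
      simpa [huv, huv.symm] using this
    · have hr' : ¬ (v ∈ Set.range ι ∧ u ∈ Set.range ι) := fun h => hr h.symm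
      have h1 : ¬ ∃ i j, ι i = u ∧ ι j = v ∧ D.Adj i j := by
        rintro ⟨i, j, rfl, rfl, -⟩
        exact hr ⟨⟨i, rfl⟩, ⟨j, rfl⟩⟩
      have h2 : ¬ ∃ i j, ι i = v ∧ ι j = u ∧ D.Adj i j := by
        rintro ⟨i, j, rfl, rfl, -⟩
        exact hr ⟨⟨j, rfl⟩, ⟨i, rfl⟩⟩
      rcases lt_or_gt_of_ne huv.ne with hlt | hlt
      · exact Or.inl ⟨⟨huv, Or.inr ⟨hr, hlt⟩⟩,
          fun h => h.2.elim h2 fun h => lt_asymm h.2 hlt⟩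
      · exact Or.inr ⟨⟨huv.symm, Or.inr ⟨hr', hlt⟩⟩,
          fun h => h.2.elim h1 fun h => lt_asymm h.2 hlt⟩
  · rintro ⟨s, t⟩ hst
    obtain ⟨⟨i, hi⟩, ⟨j, hj⟩⟩ := hT _ hst
    dsimp only at hi hj
    subst hi hj
    refine Relation.ReflTransGen.lift ι (r := ((I.comap ι).G.orient D).Adj) ?_ _ _
      (hp (i, j) ((I.mem_comap ι _).2 hst))
    rintro a b (h | h)
    · exact Or.inl h
    · exact Or.inr ⟨hD.adj_of_arc a b h, Or.inl ⟨a, b, rfl, rfl, h⟩⟩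

/-- Some orientation of the edges at `w` makes `x, w, y` a directed path, unless `x = y`. -/
def MixedGraph.Provides {V : Type*} (G : MixedGraph V) (w x y : V) : Prop :=
  (G.A.Adj x w ∨ G.E.Adj x w) ∧ (G.A.Adj w y ∨ G.E.Adj w y)

/-- If `R` is independent, contains all deleted vertices but no terminals, and each pair provided
by a vertex of `R` can be assigned a kept vertex of `R` providing it, no vertex being used twice,
then the induced subinstance of a yes-instance is a yes-instance. -/
theorem Instance.isYes_comap (I : Instance) {m : ℕ} (ι : Fin m ↪ Fin I.n) (R : Fin I.n → Prop)
    (src : Fin I.n → Fin I.n) (hR : ∀ v, ¬ R v → v ∈ Set.range ι)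
    (hind : ∀ u v, R u → R v → ¬ I.G.underlying.Adj u v)
    (hT : ∀ p ∈ I.T, ¬ R p.1 ∧ ¬ R p.2)
    (hprov : ∀ w x y, R w → I.G.Provides w x y →
      ∃ i, R (ι i) ∧ src (ι i) = x ∧ I.G.Provides (ι i) x y)
    (h : I.IsYes) : (I.comap ι).IsYes := by
  classical
  obtain ⟨D, hD, hp⟩ := h
  -- At a kept vertex of `R`, the edge from its source points inwards and all other edges point
  -- outwards; edges avoiding `R` keep their orientation.
  let D' : Digraph (Fin m) := { Adj := fun i j => I.G.E.Adj (ι i) (ι j) ∧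
    (if R (ι i) then ι j ≠ src (ι i) else if R (ι j) then ι i = src (ι j) else
      D.Adj (ι i) (ι j)) }
  have hD' : IsOrientation (I.comap ι).G.E D' := by
    refine ⟨fun i j h => h.1, fun i j (hij : I.G.E.Adj (ι i) (ι j)) => ?_⟩
    have hi := hD.exactly_one _ _ hij
    by_cases h1 : R (ι i)
    · have h2 : ¬ R (ι j) := fun h2 => hind _ _ h1 h2 (Or.inl hij)
      by_cases h3 : ι j = src (ι i) <;> simp [D', Xor, h1, h2, h3, hij, hij.symm]
      simp [← h3, h2, hij.symm]
    · by_cases h2 : R (ι j)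
      · by_cases h3 : ι i = src (ι j) <;> simp [D', Xor, h1, h2, h3, hij, hij.symm]
        simp [← h3, h1, hij]
      · simpa [D', Xor, h1, h2, hij, hij.symm] using hi
  refine ⟨D', hD', ?_⟩
  rintro ⟨s, t⟩ hst
  have hst' : (ι s, ι t) ∈ I.T := (I.mem_comap ι (s, t)).1 hst
  have adj : ∀ a b, (I.G.orient D).Adj a b → I.G.underlying.Adj a b := fun a b h =>
    h.elim (fun h => Or.inr (Or.inl h)) fun h => Or.inl (hD.adj_of_arc _ _ h)
  have out : ∀ a b, (I.G.orient D).Adj a b → I.G.A.Adj a b ∨ I.G.E.Adj a b := fun a b h =>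
    h.imp_right (hD.adj_of_arc _ _)
  -- Induction along the old path. At a vertex of `R`, possibly deleted, only its predecessor is
  -- claimed to be reachable; the detour is made on leaving `R`, which happens at the next step
  -- because `R` is independent.
  have key : ∀ b, HasDirectedPath (I.G.orient D) (ι s) b →
      (¬ R b → ∃ j, ι j = b ∧ HasDirectedPath ((I.comap ι).G.orient D') s j) ∧
      (R b → ∃ j, (I.G.orient D).Adj (ι j) b ∧
        HasDirectedPath ((I.comap ι).G.orient D') s j) := by
    intro b hb
    induction hb with
    | refl => exact ⟨fun _ => ⟨s, rfl, .refl⟩, fun h => absurd h (hT _ hst').1⟩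
    | @tail b c hb hbc ih =>
      by_cases hRb : R b
      · have hRc : ¬ R c := fun h => hind _ _ hRb h (adj _ _ hbc)
        refine ⟨fun _ => ?_, fun h => absurd h hRc⟩
        obtain ⟨j, hj, hsj⟩ := ih.2 hRb
        obtain ⟨l, rfl⟩ := hR c hRc
        -- If the path returns to the vertex it came from, the passage is dropped: a single edge at
        -- a vertex of `R` could not be traversed both ways.
        by_cases hjl : j = l
        · exact ⟨j, by rw [hjl], hsj⟩
        obtain ⟨i, hRi, hsrc, hin, hout⟩ := hprov b (ι j) (ι l) hRb ⟨out _ _ hj, out _ _ hbc⟩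
        have hRj : ¬ R (ι j) := fun h => hind _ _ h hRb (adj _ _ hj)
        have hne : ι l ≠ ι j := fun h => hjl (ι.injective h).symm
        refine ⟨l, rfl, (hsj.tail (b := j) (c := i) ?_).tail ?_⟩
        · refine hin.imp id fun h => ⟨h, ?_⟩
          simp [hRj, hRi, hsrc]
        · refine hout.imp id fun h => ⟨h, ?_⟩
          simp [hRi, hsrc, hne]
      · obtain ⟨j, rfl, hsj⟩ := ih.1 hRb
        refine ⟨fun hRc => ?_, fun _ => ⟨j, hbc, hsj⟩⟩
        obtain ⟨l, rfl⟩ := hR c hRc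
        refine ⟨l, rfl, hsj.tail (hbc.imp id fun h => ⟨hD.adj_of_arc _ _ h, ?_⟩)⟩
        simpa [hRb, hRc] using h
  obtain ⟨j, hj, hsj⟩ := (key (ι t) (hp _ hst')).1 (hT _ hst').2
  rwa [ι.injective hj] at hsj

/-! ### Auctions

An auction computes a maximum matching of the free vertices into the pairs they provide. Each pair
`(x, y)` has a price `h x y` and possibly a holder `v`, recorded as `H x y = v + 1`; whether `v` is
kept is recorded in `K (v + 1) 0`. -/

/-- The sum of the prices. -/
def total (n : ℕ) (h : ℕ → ℕ → ℕ) : ℕ :=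
  ∑ p ∈ Finset.range n ×ˢ Finset.range n, h p.1 p.2

/-- The invariants of an auction with maximal price `L`. -/
structure Auction (n L : ℕ) (prov : ℕ → ℕ → ℕ → Prop) (fixed : ℕ → Prop)
    (K h H : ℕ → ℕ → ℕ) : Prop where
  fixed_kept : ∀ v < n, fixed v → K (v + 1) 0 ≠ 0
  kept : ∀ v < n, K (v + 1) 0 ≠ 0 → fixed v ∨ ∃ x y, H x y = v + 1
  held : ∀ x y v, H x y = v + 1 → v < n ∧ ¬ fixed v ∧ K (v + 1) 0 ≠ 0 ∧ prov v x y
  tight : ∀ x y v x' y', H x y = v + 1 → prov v x' y' → h x y ≤ h x' y' + 1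
  inj : ∀ x y x' y', H x y ≠ 0 → H x y = H x' y' → x = x' ∧ y = y'
  holder : ∀ x y, h x y ≠ 0 → H x y ≠ 0
  le : ∀ x y, h x y ≤ L

/-- Every pair provided by a vertex below `m` that is not kept has price at least `L`. -/
def Settled (L : ℕ) (prov : ℕ → ℕ → ℕ → Prop) (m : ℕ) (K h : ℕ → ℕ → ℕ) : Prop :=
  ∀ v < m, K (v + 1) 0 = 0 → ∀ x y, prov v x y → L ≤ h x y

section

variable {n L : ℕ} {prov : ℕ → ℕ → ℕ → Prop} {fixed : ℕ → Prop} {K h H : ℕ → ℕ → ℕ}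

theorem Auction.init (hK : ∀ v < n, K (v + 1) 0 ≠ 0 ↔ fixed v) (hh : ∀ x y, h x y = 0)
    (hH : ∀ x y, H x y = 0) : Auction n L prov fixed K h H where
  fixed_kept v hv := (hK v hv).2
  kept v hv hk := Or.inl ((hK v hv).1 hk)
  held x y v hv := by simp [hH] at hv
  tight x y v x' y' hv := by simp [hH] at hv
  inj x y x' y' h := absurd (hH x y) h
  holder x y h := absurd (hh x y) h
  le x y := by simp [hh]

/-- The vertex `v` acquires the pair `(x, y)`, whose previous holder is dropped. -/
theorem Auction.push (a : Auction n L prov fixed K h H) {v x y : ℕ} (hv : v < n)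
    (hK : K (v + 1) 0 = 0) (hp : prov v x y)
    (hmin : ∀ x' y', prov v x' y' → h x y ≤ h x' y') (hL : h x y < L) :
    Auction n L prov fixed (upd (upd K (H x y) 0 0) (v + 1) 0 1) (upd h x y (h x y + 1))
      (upd H x y (v + 1)) := by
  -- If the pair has no holder, then `H x y = 0` and the eviction only clears `K 0 0`, which belongs
  -- to no vertex.
  have hfree : ∀ x' y', H x' y' ≠ v + 1 := fun x' y' e => (a.held _ _ _ e).2.2.1 hK
  have hnf : ¬ fixed v := fun hf => a.fixed_kept v hv hf hK
  have hmono : ∀ x' y', h x' y' ≤ upd h x y (h x y + 1) x' y' := by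
    intro x' y'
    rw [upd_apply]
    split_ifs with hc
    · rw [hc.1, hc.2]
      omega
    · exact le_rfl
  refine ⟨?_, ?_, ?_, ?_, ?_, ?_, ?_⟩
  · intro w hw hf
    have h1 : w ≠ v := fun e => hnf (e ▸ hf)
    have h2 : H x y ≠ w + 1 := fun e => (a.held _ _ _ e).2.1 hf
    simpa [upd_apply, h1, h2.symm] using a.fixed_kept w hw hf
  · intro w hw hk
    by_cases h1 : w = v
    · exact Or.inr ⟨x, y, by simp [h1]⟩
    · by_cases h2 : w + 1 = H x y
      · simp [upd_apply, h2] at hk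
        simp [← h2, h1] at hk
      · simp only [upd_apply, h2, Nat.add_right_cancel_iff, h1, false_and, if_false] at hk
        refine (a.kept w hw hk).imp_right ?_
        rintro ⟨x', y', e⟩
        refine ⟨x', y', ?_⟩
        rw [upd_apply, if_neg, e]
        rintro ⟨rfl, rfl⟩
        exact h2 e.symm
  · intro x' y' w e
    rw [upd_apply] at e
    split_ifs at e with hc
    · obtain rfl : v = w := by omega
      obtain ⟨rfl, rfl⟩ := hc
      exact ⟨hv, hnf, by simp, hp⟩
    · obtain ⟨h1, h2, h3, h4⟩ := a.held _ _ _ e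
      refine ⟨h1, h2, ?_, h4⟩
      have h5 : w + 1 ≠ H x y := fun e' => hc (a.inj _ _ _ _ (by omega) (e.trans e'))
      rw [upd_apply]
      split_ifs
      · omega
      · simpa [upd_apply, h5] using h3
  -- For `v`, the pair was cheapest before its price rose by one. For the other holders, the price
  -- of their own pair is unchanged and other prices only rise.
  · intro x' y' w x'' y'' e hw
    refine le_trans ?_ (Nat.add_le_add_right (hmono x'' y'') 1)
    rw [upd_apply] at e ⊢
    split_ifs at e ⊢ with hc
    · obtain rfl : v = w := by omega
      have := hmin _ _ hw
      omega
    · exact a.tight _ _ _ _ _ e hw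
  · intro x₁ y₁ x₂ y₂ h0 e
    simp only [upd_apply] at h0 e
    split_ifs at h0 e with h1 h2 h2
    · exact ⟨h1.1.trans h2.1.symm, h1.2.trans h2.2.symm⟩
    · exact absurd e.symm (hfree _ _)
    · exact absurd e (hfree _ _)
    · exact a.inj _ _ _ _ h0 e
  · intro x' y' h0
    simp only [upd_apply] at h0 ⊢
    split_ifs at h0 ⊢
    · omega
    · exact a.holder _ _ h0
  · intro x' y'
    rw [upd_apply]
    split_ifs
    · omega
    · exact a.le _ _

theorem total_upd {x y : ℕ} (hx : x < n) (hy : y < n) :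
    total n h + 1 ≤ total n (upd h x y (h x y + 1)) := by
  unfold total
  refine Finset.sum_lt_sum (f := fun p : ℕ × ℕ => h p.1 p.2)
    (g := fun p : ℕ × ℕ => upd h x y (h x y + 1) p.1 p.2) ?_
    ⟨(x, y), Finset.mk_mem_product (Finset.mem_range.2 hx) (Finset.mem_range.2 hy), by simp⟩
  rintro ⟨x', y'⟩ -
  simp only [upd_apply]
  split_ifs with hc
  · rw [hc.1, hc.2]
    omega
  · exact le_rfl

theorem Auction.total_le (a : Auction n L prov fixed K h H) : total n h ≤ n * n * L := by
  refine (Finset.sum_le_card_nsmul _ _ L fun p _ => a.le _ _).trans ?_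
  simp

/-- In a settled auction with `L = n * n + 1` some price does not occur, which separates a
saturated set of pairs from the rest. -/
theorem Auction.exists_gap (a : Auction n (n * n + 1) prov fixed K h H)
    (hset : Settled (n * n + 1) prov n K h)
    (hlt : ∀ v x y, prov v x y → v < n ∧ x < n ∧ y < n) :
    ∃ R : ℕ → Prop, (∀ v, R v → v < n ∧ ¬ fixed v) ∧ (∀ v < n, ¬ R v → K (v + 1) 0 ≠ 0) ∧
      ∀ w x y, R w → prov w x y → ∃ v, R v ∧ K (v + 1) 0 ≠ 0 ∧ H x y = v + 1 ∧ prov v x y := by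
  -- Pigeonhole: `n * n` pairs cannot attain `n * n + 1` different prices.
  obtain ⟨j, hj, hgap⟩ : ∃ j ∈ Finset.Icc 1 (n * n + 1),
      j ∉ (Finset.range n ×ˢ Finset.range n).image fun p => h p.1 p.2 := by
    refine Finset.exists_mem_notMem_of_card_lt_card (lt_of_le_of_lt Finset.card_image_le ?_)
    simp
  rw [Finset.mem_Icc] at hj
  have hne : ∀ v x y, prov v x y → h x y ≠ j := by
    intro v x y hp e
    obtain ⟨-, hx, hy⟩ := hlt v x y hp
    exact hgap (Finset.mem_image.2 ⟨(x, y), by simp [hx, hy], e⟩)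
  refine ⟨fun v => v < n ∧ ¬ fixed v ∧ (K (v + 1) 0 = 0 ∨ ∃ x y, H x y = v + 1 ∧ j < h x y),
    fun v hv => ⟨hv.1, hv.2.1⟩, fun v hv hR hK => hR ⟨hv, ?_, Or.inl hK⟩, ?_⟩
  · exact fun hf => a.fixed_kept v hv hf hK
  · rintro w x y ⟨hw, -, hcase⟩ hp
    -- Being settled or tight gives only `j ≤ h x y`; equality is excluded because the price `j`
    -- does not occur. A positive price then yields a holder, which lies in `R` as well.
    have hj' : j < h x y := by
      have h1 := hne w x y hp
      rcases hcase with hK | ⟨x', y', e, hlt'⟩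
      · have := hset w hw hK x y hp
        omega
      · have := a.tight _ _ _ _ _ e hp
        omega
    obtain ⟨v, e⟩ := Nat.exists_eq_succ_of_ne_zero (a.holder x y (by omega))
    obtain ⟨h1, h2, h3, h4⟩ := a.held x y v e
    exact ⟨v, ⟨h1, h2, Or.inr ⟨x, y, e, hj'⟩⟩, h3, e, h4⟩

end

/-! ### The kernel -/

namespace Instance

variable (I : Instance)

/-- An edge or an arc leads from `u` to `v`. -/
def Link (u v : ℕ) : Prop := I.encode 1 u v + I.encode 2 u v ≠ 0

/-- The vertex `w` provides the pair `(x, y)`. -/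
def Prov (w x y : ℕ) : Prop := I.Link x w ∧ I.Link w y

theorem encode_one (u v : Fin I.n) : I.encode 1 u v ≠ 0 ↔ I.G.E.Adj u v := by
  simp [encode, Fin.val_inj]

theorem encode_two (u v : Fin I.n) : I.encode 2 u v ≠ 0 ↔ I.G.A.Adj u v := by
  simp [encode, Fin.val_inj]

theorem encode_three (u v : Fin I.n) : I.encode 3 u v ≠ 0 ↔ (u, v) ∈ I.T := by
  simp [encode, Fin.val_inj]

theorem lt_of_encode {a i j : ℕ} (ha : a ∈ ({1, 2, 3} : Set ℕ)) (h : I.encode a i j ≠ 0) :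
    i < I.n ∧ j < I.n := by
  have h0 : a ≠ 0 := by rintro rfl; simp at ha
  unfold encode at h
  simp only [h0, false_and, if_false] at h
  split_ifs at h with h1 h2 h3
  · obtain ⟨-, u, v, rfl, rfl, -⟩ := h1
    exact ⟨u.2, v.2⟩
  · obtain ⟨-, u, v, rfl, rfl, -⟩ := h2
    exact ⟨u.2, v.2⟩
  · obtain ⟨-, u, v, rfl, rfl, -⟩ := h3
    exact ⟨u.2, v.2⟩
  · exact absurd rfl h

theorem Link.lt {I : Instance} {u v : ℕ} (h : I.Link u v) : u < I.n ∧ v < I.n := by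
  unfold Link at h
  by_cases h1 : I.encode 1 u v = 0
  · exact I.lt_of_encode (a := 2) (by simp) (by omega)
  · exact I.lt_of_encode (by simp) h1

theorem link_iff (u v : Fin I.n) : I.Link u v ↔ I.G.A.Adj u v ∨ I.G.E.Adj u v := by
  rw [← encode_one, ← encode_two, Link]
  omega

theorem prov_iff (w x y : Fin I.n) : I.Prov w x y ↔ I.G.Provides w x y := by
  rw [Prov, link_iff, link_iff, MixedGraph.Provides]

theorem Link.ne {I : Instance} {u v : ℕ} (h : I.Link u v) : u ≠ v := by
  rintro rfl
  obtain ⟨hu, -⟩ := h.lt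
  exact ((I.link_iff ⟨u, hu⟩ ⟨u, hu⟩).1 h).elim (I.G.loopless _) fun e => e.ne rfl

theorem encode_le_one {a : ℕ} (ha : a ≠ 0) (i j : ℕ) : I.encode a i j ≤ 1 := by
  simp only [encode, ha, false_and, if_false]
  split_ifs <;> simp

theorem encode_comap {m : ℕ} (ι : Fin m ↪ Fin I.n) {a : ℕ} (ha : a ∈ ({1, 2, 3} : Set ℕ))
    (i j : Fin m) : (I.comap ι).encode a i j = I.encode a (ι i) (ι j) := by
  have h0 : a ≠ 0 := by rintro rfl; simp at ha
  have h1 := (I.comap ι).encode_le_one h0 i j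
  have h2 := I.encode_le_one h0 (ι i) (ι j)
  -- Both entries are `0` or `1`, so it suffices to compare whether they vanish.
  have h3 : (I.comap ι).encode a i j ≠ 0 ↔ I.encode a (ι i) (ι j) ≠ 0 := by
    rcases ha with rfl | rfl | rfl
    · exact ((I.comap ι).encode_one i j).trans (I.encode_one (ι i) (ι j)).symm
    · exact ((I.comap ι).encode_two i j).trans (I.encode_two (ι i) (ι j)).symm
    · exact ((I.comap ι).encode_three i j).trans
        ((I.mem_comap ι (i, j)).trans (I.encode_three (ι i) (ι j)).symm)
  omega

/-- `v` is marked in `X` or is a terminal. -/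
def Fixed (X : ℕ → ℕ → ℕ) (v : ℕ) : Prop :=
  X v 0 ≠ 0 ∨ ∃ u, I.encode 3 u v ≠ 0 ∨ I.encode 3 v u ≠ 0

/-- The set of vertices marked in `X`. -/
def marked (X : ℕ → ℕ → ℕ) : Finset ℕ := (Finset.range I.n).filter fun v => X v 0 ≠ 0

/-- `I'` is a possible output of the kernelization algorithm on input `I`. -/
def IsKernel (I' : Instance) : Prop :=
  (I.IsYes ↔ I'.IsYes) ∧ I'.n ≤ 6 * (I.vc ^ 2 + I.k) ∧ I'.k ≤ I.k

theorem exists_cover : ∃ S : Finset ℕ, S.card = I.vc ∧ ∀ u v, I.Link u v → u ∈ S ∨ v ∈ S := by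
  classical
  obtain ⟨s, hs, hc⟩ := SimpleGraph.vertexCoverNum_exists I.G.underlying
  have hfin := Set.toFinite s
  refine ⟨hfin.toFinset.map Fin.valEmbedding, ?_, ?_⟩
  · rw [Finset.card_map, ← Nat.cast_inj (R := ℕ∞), coe_vc, ← hs, hfin.encard_eq_coe_toFinset_card]
  · intro u v h
    obtain ⟨hu, hv⟩ := h.lt
    have hadj : I.G.underlying.Adj ⟨u, hu⟩ ⟨v, hv⟩ :=
      ((I.link_iff ⟨u, hu⟩ ⟨v, hv⟩).1 h).elim (fun h => Or.inr (Or.inl h)) Or.inl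
    refine (hc hadj).imp ?_ ?_ <;> intro h <;>
      exact Finset.mem_map.2 ⟨_, hfin.mem_toFinset.2 h, rfl⟩

theorem card_fixed (X : ℕ → ℕ → ℕ) (F : Finset ℕ) (hF : ∀ v ∈ F, v < I.n ∧ I.Fixed X v) :
    F.card ≤ (I.marked X).card + 2 * I.k := by
  classical
  have hsub : F ⊆ I.marked X ∪ (I.T.image (fun p => (p.1 : ℕ)) ∪
      I.T.image fun p => (p.2 : ℕ)) := by
    intro v hv
    obtain ⟨hlt, hX | ⟨u, hu | hu⟩⟩ := hF v hv
    · exact Finset.mem_union_left _ (by simp [marked, hlt, hX])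
    · have hu' := (I.lt_of_encode (by simp) hu).1
      refine Finset.mem_union_right _ (Finset.mem_union_right _ (Finset.mem_image.2
        ⟨(⟨u, hu'⟩, ⟨v, hlt⟩), (I.encode_three _ _).1 hu, rfl⟩))
    · have hu' := (I.lt_of_encode (by simp) hu).2
      refine Finset.mem_union_right _ (Finset.mem_union_left _ (Finset.mem_image.2
        ⟨(⟨v, hlt⟩, ⟨u, hu'⟩), (I.encode_three _ _).1 hu, rfl⟩))
  refine (Finset.card_le_card hsub).trans ((Finset.card_union_le _ _).trans ?_)
  have h1 := Finset.card_union_le (I.T.image (fun p => (p.1 : ℕ))) (I.T.image fun p => (p.2 : ℕ))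
  have h2 := Finset.card_image_le (s := I.T) (f := fun p => (p.1 : ℕ))
  have h3 := Finset.card_image_le (s := I.T) (f := fun p => (p.2 : ℕ))
  rw [k]
  omega

theorem isKernel_comap {X K h H : ℕ → ℕ → ℕ}
    (hX : ∀ u v, I.Link u v → X u 0 ≠ 0 ∨ X v 0 ≠ 0) (hc : (I.marked X).card ≤ 2 * I.vc)
    (a : Auction I.n (I.n * I.n + 1) I.Prov (I.Fixed X) K h H)
    (hset : Settled (I.n * I.n + 1) I.Prov I.n K h) {m : ℕ} (ι : Fin m ↪ Fin I.n)
    (hι : ∀ v : Fin I.n, v ∈ Set.range ι ↔ K (v + 1) 0 ≠ 0) : I.IsKernel (I.comap ι) := by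
  classical
  have hT : ∀ p ∈ I.T, I.Fixed X p.1 ∧ I.Fixed X p.2 := fun p hp =>
    ⟨Or.inr ⟨p.2, Or.inr ((I.encode_three _ _).2 hp)⟩,
      Or.inr ⟨p.1, Or.inl ((I.encode_three _ _).2 hp)⟩⟩
  refine ⟨⟨?_, I.isYes_of_comap ι fun p hp => ?_⟩, ?_, I.k_comap_le ι⟩
  · obtain ⟨R, h1, h2, h3⟩ := a.exists_gap hset fun v x y hp => ⟨hp.1.lt.2, hp.1.lt.1, hp.2.lt.2⟩
    -- A vertex holds at most one pair, whose first entry is its source; the value for a vertex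
    -- without a pair is irrelevant.
    have hsrc : ∀ v : Fin I.n, ∃ x : Fin I.n, ∀ x' : Fin I.n, ∀ y, H x' y = v + 1 → x' = x := by
      intro v
      by_cases hv : ∃ x : Fin I.n, ∃ y, H x y = v + 1
      · obtain ⟨x, y, e⟩ := hv
        exact ⟨x, fun x' y' e' => Fin.ext (a.inj _ _ _ _ (by omega) (e'.trans e.symm)).1⟩
      · exact ⟨v, fun x' y e => absurd ⟨x', y, e⟩ hv⟩
    choose src hsrc using hsrc
    refine I.isYes_comap ι (fun v => R v) src (fun v hv => (hι v).2 (h2 v v.2 hv)) ?_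
      (fun p hp => ⟨fun hR => (h1 _ hR).2 (hT p hp).1, fun hR => (h1 _ hR).2 (hT p hp).2⟩) ?_
    · intro u v hu hv huv
      have key : ∀ u v : Fin I.n, R u → R v → ¬ I.Link u v := fun u v hu hv hl =>
        (hX _ _ hl).elim (fun h => (h1 _ hu).2 (Or.inl h)) fun h => (h1 _ hv).2 (Or.inl h)
      rcases huv with h | h | h
      · exact key u v hu hv ((I.link_iff _ _).2 (Or.inr h))
      · exact key u v hu hv ((I.link_iff _ _).2 (Or.inl h))
      · exact key v u hv hu ((I.link_iff _ _).2 (Or.inl h))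
    · intro w x y hw hp
      obtain ⟨v, hR, hK, e, hp'⟩ := h3 w x y hw ((I.prov_iff w x y).2 hp)
      have hv := (h1 v hR).1
      obtain ⟨i, hi⟩ := (hι ⟨v, hv⟩).2 hK
      refine ⟨i, ?_, ?_, ?_⟩
      · rw [hi]
        exact hR
      · rw [hi]
        exact (hsrc ⟨v, hv⟩ x y e).symm
      · rw [hi]
        exact (I.prov_iff _ x y).1 hp'
  · exact ⟨(hι _).2 (a.fixed_kept _ p.1.2 (hT p hp).1), (hι _).2 (a.fixed_kept _ p.2.2 (hT p hp).2)⟩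
  · set N := (Finset.range I.n).filter fun v => K (v + 1) 0 ≠ 0 with hN
    have hm : m ≤ N.card := by
      have : ((Finset.univ : Finset (Fin m)).image fun i => (ι i : ℕ)).card = m := by
        refine (Finset.card_image_of_injective _ (Fin.val_injective.comp ι.injective)).trans ?_
        simp
      rw [← this]
      refine Finset.card_le_card fun v hv => ?_
      obtain ⟨i, -, rfl⟩ := Finset.mem_image.1 hv
      exact Finset.mem_filter.2 ⟨Finset.mem_range.2 (ι i).2, (hι _).1 ⟨i, rfl⟩⟩
    have hf := I.card_fixed X (N.filter (I.Fixed X)) fun v hv => by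
      simp only [hN, Finset.mem_filter, Finset.mem_range] at hv
      exact ⟨hv.1.1, hv.2⟩
    -- A kept free vertex is determined by the pair it holds, and both entries lie in the cover
    -- since the vertex itself does not.
    have hh : (N.filter fun v => ¬ I.Fixed X v).card ≤ (I.marked X ×ˢ I.marked X).card := by
      have : ∀ v ∈ N.filter fun v => ¬ I.Fixed X v, ∃ p ∈ I.marked X ×ˢ I.marked X,
          H p.1 p.2 = v + 1 := by
        intro v hv
        simp only [hN, Finset.mem_filter, Finset.mem_range] at hv
        obtain ⟨⟨hv, hK⟩, hnf⟩ := hv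
        obtain ⟨x, y, e⟩ := (a.kept v hv hK).resolve_left hnf
        obtain ⟨-, -, -, hp⟩ := a.held x y v e
        have hXv : X v 0 = 0 := by
          by_contra h0
          exact hnf (Or.inl h0)
        refine ⟨(x, y), ?_, e⟩
        simp only [marked, Finset.mem_product, Finset.mem_filter, Finset.mem_range]
        exact ⟨⟨hp.1.lt.1, (hX _ _ hp.1).resolve_right (by simp [hXv])⟩,
          hp.2.lt.2, (hX _ _ hp.2).resolve_left (by simp [hXv])⟩
      choose! p hp using this
      refine Finset.card_le_card_of_injOn p (fun v hv => (hp v hv).1) fun v hv w hw e => ?_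
      have h1 := (hp v hv).2
      have h2 := (hp w hw).2
      rw [e] at h1
      omega
    have hsum := Finset.card_filter_add_card_filter_not (s := N) (I.Fixed X)
    rw [Finset.card_product] at hh
    have hsq := Nat.mul_le_mul hc hc
    have hvc := Nat.le_self_pow two_ne_zero I.vc
    change m ≤ _
    -- The bounds add up to `2 vc + 2 k + 4 vc ^ 2`, and `vc ≤ vc ^ 2`.
    nlinarith

end Instance

/-! ### Invariants of the program

The arrays `0`–`3` hold the input, `4` the vertex cover `X`, `5` the marks `K` of the kept vertices,
`6` and `7` the maximal price and the number of rounds of the auction, `8` and `9` its prices and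
holders, `10` and `11` the list of the kept vertices and its length; all further arrays are
counters. -/

/-- The input is intact. -/
def HasInput (I : Instance) (σ : Memory) : Prop := ∀ a < 4, σ a = I.encode a

/-- The arrays from `m` on are empty, except for the counters. -/
def Fresh (m : ℕ) (σ : Memory) : Prop := ∀ a, m ≤ a → a < 12 → ∀ i j, σ a i j = 0

theorem HasInput.write {I : Instance} {σ : Memory} (h : HasInput I σ) {a : ℕ} (ha : 4 ≤ a)
    (i j x : ℕ) : HasInput I (σ.write a i j x) := fun b hb => by
  rw [write_of_ne _ _ _ _ (by omega), h b hb]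

theorem HasInput.size {I : Instance} {σ : Memory} (h : HasInput I σ) : σ 0 0 0 = I.n := by
  rw [h 0 (by norm_num)]
  simp [Instance.encode]

theorem HasInput.eval_size {I : Instance} {σ : Memory} (h : HasInput I σ) :
    (Expr.get 0 (.const 0) (.const 0)).eval σ = I.n := h.size

theorem Fresh.write {m : ℕ} {σ : Memory} (h : Fresh m σ) {a : ℕ} (ha : a < m ∨ 12 ≤ a)
    (i j x : ℕ) : Fresh m (σ.write a i j x) := fun b hb hb' i' j' => by
  rw [write_of_ne _ _ _ _ (by omega), h b hb hb']

theorem Fresh.mono {m m' : ℕ} {σ : Memory} (h : Fresh m σ) (hm : m ≤ m') : Fresh m' σ :=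
  fun b hb => h b (hm.trans hb)

theorem hasInput_encode (I : Instance) : HasInput I I.encode := fun _ _ => rfl

theorem fresh_encode (I : Instance) : Fresh 4 I.encode := by
  intro a ha _ i j
  have h0 : a ≠ 0 := by omega
  have h1 : a ≠ 1 := by omega
  have h2 : a ≠ 2 := by omega
  have h3 : a ≠ 3 := by omega
  simp [Instance.encode, h0, h1, h2, h3]

/-- The entry of the array `a` at the indices given by two scalars. -/
abbrev Expr.entry (a i j : ℕ) : Expr := .get a (.var i) (.var j)

/-- The entry of the one-dimensional array `a` at the index given by a scalar. -/
abbrev Expr.at (a i : ℕ) : Expr := .get a (.var i) (.const 0)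

/-- The entry of the one-dimensional array `a` at one plus the index given by a scalar. -/
abbrev Expr.next (a i : ℕ) : Expr := .get a (.add (.var i) (.const 1)) (.const 0)

/-! ### The vertex cover -/

/-- The greedy algorithm for vertex cover has processed all pairs before `(i, j)`. -/
structure PartialCover (I : Instance) (S : Finset ℕ) (i j : ℕ) (X : ℕ → ℕ → ℕ) : Prop where
  cover : ∀ u v, I.Link u v → u < i ∨ u = i ∧ v < j → X u 0 ≠ 0 ∨ X v 0 ≠ 0
  card : (I.marked X).card ≤ 2 * (I.marked X ∩ S).card

theorem PartialCover.skip {I : Instance} {S : Finset ℕ} {i j : ℕ} {X : ℕ → ℕ → ℕ}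
    (h : PartialCover I S i j X) (hX : I.Link i j → X i 0 ≠ 0 ∨ X j 0 ≠ 0) :
    PartialCover I S i (j + 1) X := by
  refine ⟨fun u v huv hlt => ?_, h.card⟩
  by_cases he : u = i ∧ v = j
  · obtain ⟨rfl, rfl⟩ := he
    exact hX huv
  · exact h.cover u v huv (by omega)

theorem PartialCover.row {I : Instance} {S : Finset ℕ} {i : ℕ} {X : ℕ → ℕ → ℕ}
    (h : PartialCover I S i I.n X) : PartialCover I S (i + 1) 0 X :=
  ⟨fun u v huv hlt => h.cover u v huv (by have := huv.lt; omega), h.card⟩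

/-- Two vertices are marked, and at least one of them is a new element of the cover `S`, which
preserves the factor `2`. -/
theorem PartialCover.mark {I : Instance} {S : Finset ℕ}
    (hS : ∀ u v, I.Link u v → u ∈ S ∨ v ∈ S) {i j : ℕ} {X : ℕ → ℕ → ℕ}
    (h : PartialCover I S i j X) (hl : I.Link i j) (hi : X i 0 = 0) (hj : X j 0 = 0) :
    PartialCover I S i (j + 1) (upd (upd X i 0 1) j 0 1) := by
  set X' := upd (upd X i 0 1) j 0 1 with hX'
  have hmono : ∀ u, X u 0 ≠ 0 → X' u 0 ≠ 0 := by
    intro u hu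
    simp only [hX', upd_apply]
    split_ifs <;> simp_all
  have hi' : X' i 0 ≠ 0 := by
    simp only [hX', upd_apply]
    split_ifs <;> simp_all
  have hj' : X' j 0 ≠ 0 := by simp [hX']
  refine PartialCover.skip ⟨fun u v huv hlt => (h.cover u v huv hlt).imp (hmono u) (hmono v), ?_⟩
    fun _ => Or.inl hi'
  have hM : I.marked X' = insert i (insert j (I.marked X)) := by
    ext u
    simp only [Instance.marked, Finset.mem_insert, Finset.mem_filter, Finset.mem_range, hX',
      upd_apply]
    have := hl.lt
    by_cases h1 : u = i <;> by_cases h2 : u = j <;> simp [h1, h2, this]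
  have hin : i ∉ I.marked X := by simp [Instance.marked, hi]
  have hjn : j ∉ I.marked X := by simp [Instance.marked, hj]
  have hlt : (I.marked X ∩ S).card < (I.marked X' ∩ S).card := by
    refine Finset.card_lt_card (Finset.ssubset_iff_of_subset ?_ |>.2 ?_)
    · rw [hM]
      exact Finset.inter_subset_inter_right
        ((Finset.subset_insert _ _).trans (Finset.subset_insert _ _))
    · rcases hS i j hl with h | h
      · exact ⟨i, by simp [hM, h], by simp [hin]⟩
      · exact ⟨j, by simp [hM, h], by simp [hjn]⟩
  have h1 := Finset.card_insert_le i (insert j (I.marked X))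
  have h2 := Finset.card_insert_le j (I.marked X)
  have h3 := h.card
  rw [← hM] at h1
  omega

/-- Compute a vertex cover greedily. -/
def coverProgram : Program :=
  .for 12 (.var 0) (.for 13 (.var 0)
    (.when (.add (.entry 1 12 13) (.entry 2 12 13))
      (.when (.sub (.const 1) (.at 4 12)) (.when (.sub (.const 1) (.at 4 13))
        (.seq (.assign 4 (.var 12) (.const 0) (.const 1))
          (.assign 4 (.var 13) (.const 0) (.const 1)))))))

theorem runs_coverProgram {I : Instance} {S : Finset ℕ}
    (hS : ∀ u v, I.Link u v → u ∈ S ∨ v ∈ S) {σ : Memory} (hI : HasInput I σ) (hF : Fresh 4 σ) :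
    Runs coverProgram σ (I.n * (I.n * (8 + 2) + 2 + 2) + 2) fun τ =>
      HasInput I τ ∧ Fresh 5 τ ∧ PartialCover I S I.n 0 (τ 4) := by
  refine Runs.for (fun i τ => HasInput I τ ∧ Fresh 5 τ ∧ PartialCover I S i 0 (τ 4))
    (fun i τ h => h.1.eval_size) ?_ ⟨hI, hF.mono (by norm_num), ?_⟩ ?_
  · rintro i τ x ⟨h1, h2, h3⟩
    exact ⟨h1.write (by norm_num) _ _ _, h2.write (by norm_num) _ _ _, by simpa using h3⟩
  · refine ⟨by simp, ?_⟩
    simp [Instance.marked, hF 4]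
  rintro i hi τ ⟨h1, h2, h3⟩ hc
  refine (Runs.for (fun j τ => HasInput I τ ∧ Fresh 5 τ ∧ PartialCover I S i j (τ 4) ∧
    τ 12 0 0 = i) (fun i τ h => h.1.eval_size) ?_ ⟨h1, h2, h3, hc⟩ ?_).mono le_rfl
    fun ρ h => ⟨h.2.2.2, h.1, h.2.1, h.2.2.1.row⟩
  · rintro i τ x ⟨h1, h2, h3⟩
    exact ⟨h1.write (by norm_num) _ _ _, h2.write (by norm_num) _ _ _, by simpa using h3⟩
  rintro j hj τ ⟨h1, h2, h3, h4⟩ h5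
  have e1 := h1 1 (by norm_num)
  have e2 := h1 2 (by norm_num)
  have hskip : (I.Link i j → τ 4 i 0 ≠ 0 ∨ τ 4 j 0 ≠ 0) → τ 13 0 0 = j ∧ HasInput I τ ∧
      Fresh 5 τ ∧ PartialCover I S i (j + 1) (τ 4) ∧ τ 12 0 0 = i :=
    fun h => ⟨h5, h1, h2, h3.skip h, h4⟩
  refine Runs.when (fun hl => Runs.when (fun hi => Runs.when (fun hj => Runs.seq (Runs.assign
    (Runs.assign ?_))) fun hj => hskip fun _ => Or.inr ?_)
    fun hi => hskip fun _ => Or.inl ?_) fun hl => hskip fun h => absurd ?_ h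
  · simp only [Expr.eval, h4, h5, e1, e2] at hl hi hj ⊢
    have := h3.mark hS hl (by omega) (by omega)
    exact ⟨by simp [h5], (h1.write (by norm_num) _ _ _).write (by norm_num) _ _ _,
      (h2.write (by norm_num) _ _ _).write (by norm_num) _ _ _, by simpa [h5] using this,
      by simp [h4]⟩
  · simp only [Expr.eval, h5] at hj
    omega
  · simp only [Expr.eval, h4] at hi
    omega
  · simpa only [Expr.eval, h4, h5, e1, e2] using hl

/-! ### The fixed vertices -/

/-- The fixed vertices have been marked in `K`, as far as all pairs before `(i, j)` tell. -/
structure PartialFixed (I : Instance) (X : ℕ → ℕ → ℕ) (i j : ℕ) (K : ℕ → ℕ → ℕ) : Prop where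
  fixed : ∀ v < I.n, K (v + 1) 0 ≠ 0 → I.Fixed X v
  terminal : ∀ u v, I.encode 3 u v ≠ 0 → u < i ∨ u = i ∧ v < j →
    K (u + 1) 0 ≠ 0 ∧ K (v + 1) 0 ≠ 0
  cover : ∀ u, X u 0 ≠ 0 → u < i → K (u + 1) 0 ≠ 0

theorem PartialFixed.mark {I : Instance} {X : ℕ → ℕ → ℕ} {i j : ℕ} {K : ℕ → ℕ → ℕ}
    (h : PartialFixed I X i j K) {v : ℕ} (hv : I.Fixed X v) :
    PartialFixed I X i j (upd K (v + 1) 0 1) := by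
  have hmono : ∀ u, K (u + 1) 0 ≠ 0 → upd K (v + 1) 0 1 (u + 1) 0 ≠ 0 := by
    intro u hu
    rw [upd_apply]
    split_ifs <;> simp_all
  refine ⟨fun u hu hK => ?_, fun u w h1 h2 => (h.terminal u w h1 h2).imp (hmono u) (hmono w),
    fun u h1 h2 => hmono u (h.cover u h1 h2)⟩
  by_cases he : u = v
  · exact he ▸ hv
  · exact h.fixed u hu (by simpa [upd_apply, he] using hK)

theorem PartialFixed.next {I : Instance} {X : ℕ → ℕ → ℕ} {i j : ℕ} {K : ℕ → ℕ → ℕ}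
    (h : PartialFixed I X i j K)
    (hK : I.encode 3 i j ≠ 0 → K (i + 1) 0 ≠ 0 ∧ K (j + 1) 0 ≠ 0) :
    PartialFixed I X i (j + 1) K := by
  refine ⟨h.fixed, fun u v huv hlt => ?_, h.cover⟩
  by_cases he : u = i ∧ v = j
  · obtain ⟨rfl, rfl⟩ := he
    exact hK huv
  · exact h.terminal u v huv (by omega)

theorem PartialFixed.row {I : Instance} {X : ℕ → ℕ → ℕ} {i : ℕ} {K : ℕ → ℕ → ℕ}
    (h : PartialFixed I X i I.n K) (hK : X i 0 ≠ 0 → K (i + 1) 0 ≠ 0) :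
    PartialFixed I X (i + 1) 0 K := by
  refine ⟨h.fixed, fun u v huv hlt => h.terminal u v huv ?_, fun u hu hlt => ?_⟩
  · have := I.lt_of_encode (by simp) huv
    omega
  · by_cases he : u = i
    · subst he
      exact hK hu
    · exact h.cover u hu (by omega)

theorem PartialFixed.iff {I : Instance} {X : ℕ → ℕ → ℕ} {K : ℕ → ℕ → ℕ}
    (h : PartialFixed I X I.n 0 K) (v : ℕ) (hv : v < I.n) : K (v + 1) 0 ≠ 0 ↔ I.Fixed X v := by
  refine ⟨h.fixed v hv, ?_⟩
  rintro (hX | ⟨u, hu | hu⟩)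
  · exact h.cover v hX hv
  · exact (h.terminal u v hu (Or.inl (I.lt_of_encode (by simp) hu).1)).2
  · exact (h.terminal v u hu (Or.inl hv)).1

/-- Mark the fixed vertices. -/
def fixProgram : Program :=
  .for 12 (.var 0) (.seq
    (.for 13 (.var 0) (.when (.entry 3 12 13)
      (.seq (.assign 5 (.add (.var 12) (.const 1)) (.const 0) (.const 1))
        (.assign 5 (.add (.var 13) (.const 1)) (.const 0) (.const 1)))))
    (.when (.at 4 12) (.assign 5 (.add (.var 12) (.const 1)) (.const 0) (.const 1))))

theorem runs_fixProgram {I : Instance} {X : ℕ → ℕ → ℕ} {σ : Memory} (hI : HasInput I σ)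
    (hF : Fresh 5 σ) (hX : σ 4 = X) :
    Runs fixProgram σ (I.n * (I.n * (4 + 2) + 2 + 3 + 2) + 2) fun τ =>
      HasInput I τ ∧ Fresh 6 τ ∧ PartialFixed I X I.n 0 (τ 5) := by
  refine (Runs.for (fun i τ => HasInput I τ ∧ Fresh 6 τ ∧ PartialFixed I X i 0 (τ 5) ∧ τ 4 = X)
    (fun i τ h => h.1.eval_size) ?_ ⟨hI, hF.mono (by norm_num), ?_, hX⟩ ?_).mono le_rfl
    fun τ h => ⟨h.1, h.2.1, h.2.2.1⟩
  · rintro i τ x ⟨h1, h2, h3⟩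
    exact ⟨h1.write (by norm_num) _ _ _, h2.write (by norm_num) _ _ _, by simpa using h3⟩
  · exact ⟨fun v _ h => absurd (hF 5 le_rfl (by norm_num) _ _) h, by simp, by simp⟩
  rintro i hi τ ⟨h1, h2, h3, h4⟩ h5
  refine Runs.seq (U := 3) ((Runs.for (fun j τ => HasInput I τ ∧ Fresh 6 τ ∧
    PartialFixed I X i j (τ 5) ∧
    τ 4 = X ∧ τ 12 0 0 = i) (fun i τ h => h.1.eval_size) ?_ ⟨h1, h2, h3, h4, h5⟩ ?_).mono le_rfl ?_)
  · rintro i τ x ⟨h1, h2, h3⟩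
    exact ⟨h1.write (by norm_num) _ _ _, h2.write (by norm_num) _ _ _, by simpa using h3⟩
  · clear h1 h2 h3 h4 h5 τ
    rintro j hj τ ⟨h1, h2, h3, h4, h5⟩ h6
    have e3 := h1 3 (by norm_num)
    refine Runs.when (fun ht => Runs.seq (Runs.assign (Runs.assign ?_))) fun ht => ?_
    all_goals simp only [Expr.eval, h5, h6, e3] at ht ⊢
    · have h := ((h3.mark (Or.inr ⟨j, Or.inr ht⟩)).mark (Or.inr ⟨i, Or.inl ht⟩)).next
        fun _ => ⟨by rw [upd_apply]; split_ifs <;> simp, by simp⟩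
      exact ⟨by simp [h6], (h1.write (by norm_num) _ _ _).write (by norm_num) _ _ _,
        (h2.write (by norm_num) _ _ _).write (by norm_num) _ _ _, by simpa [h6] using h,
        by simpa using h4, by simp [h5]⟩
    · exact ⟨trivial, h1, h2, h3.next fun h => absurd ht h, h4, trivial⟩
  · clear h1 h2 h3 h4 h5 τ
    rintro τ ⟨h1, h2, h3, h4, h5⟩
    refine Runs.when (fun ht => Runs.assign ?_) fun ht => ?_
    all_goals simp only [Expr.eval, h4, h5] at ht ⊢
    · have h := (h3.mark (Or.inl ht)).row fun _ => by simp
      exact ⟨by simp [h5], h1.write (by norm_num) _ _ _, h2.write (by norm_num) _ _ _,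
        by simpa [h5] using h, by simpa using h4⟩
    · exact ⟨trivial, h1, h2, h3.row fun h => absurd ht h, trivial⟩

/-! ### The auction -/

/-- In round `r`, the vertex `v` has bid for all pairs of price at most `l` before `(x, y)` and for
all pairs of price less than `l`. In each round, the sum of the prices increases or the auction is
settled. -/
structure Bidding (n L : ℕ) (prov : ℕ → ℕ → ℕ → Prop) (fixed : ℕ → Prop) (r v l x y : ℕ)
    (K h H : ℕ → ℕ → ℕ) : Prop where
  auction : Auction n L prov fixed K h H
  prev : r ≤ total n h ∨ Settled L prov n K h
  cur : r + 1 ≤ total n h ∨ Settled L prov v K h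
  bid : K (v + 1) 0 = 0 → ∀ x' y', prov v x' y' →
    l ≤ h x' y' ∧ (x' < x ∨ x' = x ∧ y' < y → l + 1 ≤ h x' y')

section

variable {n L : ℕ} {prov : ℕ → ℕ → ℕ → Prop} {fixed : ℕ → Prop} {r v l x y : ℕ}
  {K h H : ℕ → ℕ → ℕ}

theorem Bidding.skip (b : Bidding n L prov fixed r v l x y K h H)
    (hs : K (v + 1) 0 = 0 → prov v x y → l + 1 ≤ h x y) :
    Bidding n L prov fixed r v l x (y + 1) K h H := by
  refine ⟨b.auction, b.prev, b.cur, fun hK x' y' hp => ⟨(b.bid hK x' y' hp).1, fun hlt => ?_⟩⟩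
  by_cases he : x' = x ∧ y' = y
  · obtain ⟨rfl, rfl⟩ := he
    exact hs hK hp
  · exact (b.bid hK x' y' hp).2 (by omega)

/-- By `bid`, every pair provided by `v` costs at least `l`, so a pair of price at most `l` is
cheapest. A bid below `L` shows that the auction was not settled; hence the sum was at least `r` and
is now at least `r + 1`, which also covers the case that an earlier vertex has just been evicted. -/
theorem Bidding.push (b : Bidding n L prov fixed r v l x y K h H) (hv : v < n) (hx : x < n)
    (hy : y < n) (hl : l < L) (hK : K (v + 1) 0 = 0) (hp : prov v x y) (hle : h x y ≤ l) :
    Bidding n L prov fixed r v l x (y + 1) (upd (upd K (H x y) 0 0) (v + 1) 0 1)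
      (upd h x y (h x y + 1)) (upd H x y (v + 1)) := by
  have ht := total_upd (h := h) hx hy
  have hr : r ≤ total n h := b.prev.resolve_right fun hs => by
    have := hs v hv hK x y hp
    omega
  refine ⟨b.auction.push hv hK hp (fun x' y' hp' => hle.trans (b.bid hK x' y' hp').1)
    (by omega), Or.inl (by omega), Or.inl (by omega), fun h0 => ?_⟩
  simp at h0

theorem Bidding.next_row (b : Bidding n L prov fixed r v l x n K h H)
    (hlt : ∀ v x y, prov v x y → v < n ∧ x < n ∧ y < n) :
    Bidding n L prov fixed r v l (x + 1) 0 K h H :=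
  ⟨b.auction, b.prev, b.cur, fun hK x' y' hp => ⟨(b.bid hK x' y' hp).1, fun h =>
    (b.bid hK x' y' hp).2 (by have := hlt v x' y' hp; omega)⟩⟩

theorem Bidding.next_price (b : Bidding n L prov fixed r v l n 0 K h H)
    (hlt : ∀ v x y, prov v x y → v < n ∧ x < n ∧ y < n) :
    Bidding n L prov fixed r v (l + 1) 0 0 K h H :=
  ⟨b.auction, b.prev, b.cur, fun hK x' y' hp => ⟨(b.bid hK x' y' hp).2
    (by have := hlt v x' y' hp; omega), fun h => by omega⟩⟩

/-- Having scanned all prices below `L` without being kept, `v` sees only prices of at least `L`. -/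
theorem Bidding.next_vertex (b : Bidding n L prov fixed r v L 0 0 K h H) :
    Bidding n L prov fixed r (v + 1) 0 0 0 K h H := by
  refine ⟨b.auction, b.prev, b.cur.imp_right fun hs w hw hK x' y' hp => ?_,
    fun hK x' y' hp => ⟨Nat.zero_le _, fun h => by omega⟩⟩
  by_cases he : w = v
  · subst he
    exact (b.bid hK x' y' hp).1
  · exact hs w (by omega) hK x' y' hp

theorem Bidding.next_round (b : Bidding n L prov fixed r n 0 0 0 K h H) :
    Bidding n L prov fixed (r + 1) 0 0 0 0 K h H :=
  ⟨b.auction, b.cur, Or.inr fun w hw => by omega,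
    fun _ x' y' _ => ⟨Nat.zero_le _, fun h => by omega⟩⟩

theorem Bidding.init (a : Auction n L prov fixed K h H) :
    Bidding n L prov fixed 0 0 0 0 0 K h H :=
  ⟨a, Or.inl (Nat.zero_le _), Or.inr fun w hw => by omega,
    fun _ x' y' _ => ⟨Nat.zero_le _, fun h => by omega⟩⟩

/-- The number of rounds exceeds the largest possible sum of prices, `n * n * (n * n + 1)`. -/
theorem Bidding.settled (b : Bidding n (n * n + 1) prov fixed ((n * n + 1) * (n * n + 1)) 0 0 0 0
    K h H) : Settled (n * n + 1) prov n K h := by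
  refine b.prev.resolve_left fun hr => ?_
  have := b.auction.total_le
  rw [add_mul (n * n) 1] at hr
  omega

end

theorem Instance.prov_lt (I : Instance) (v x y : ℕ) (h : I.Prov v x y) :
    v < I.n ∧ x < I.n ∧ y < I.n := ⟨h.1.lt.2, h.1.lt.1, h.2.lt.2⟩

/-- The bound on the prices. -/
def Instance.maxPrice (I : Instance) : ℕ := I.n * I.n + 1

/-- The invariant of the loops of the auction. -/
structure InAuction (I : Instance) (X : ℕ → ℕ → ℕ) (r v l x y : ℕ) (σ : Memory) : Prop where
  input : HasInput I σ
  price : σ 6 0 0 = I.maxPrice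
  rounds : σ 7 0 0 = I.maxPrice * I.maxPrice
  fresh : Fresh 10 σ
  bidding : Bidding I.n I.maxPrice I.Prov (I.Fixed X) r v l x y (σ 5) (σ 8) (σ 9)

theorem InAuction.write {I : Instance} {X : ℕ → ℕ → ℕ} {r v l x y : ℕ} {σ : Memory}
    (h : InAuction I X r v l x y σ) {a : ℕ} (ha : 12 ≤ a) (i j c : ℕ) :
    InAuction I X r v l x y (σ.write a i j c) := by
  refine ⟨h.input.write (by omega) _ _ _, ?_, ?_, h.fresh.write (Or.inr ha) _ _ _, ?_⟩
  · rw [write_of_ne _ _ _ _ (by omega), h.price]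
  · rw [write_of_ne _ _ _ _ (by omega), h.rounds]
  · rw [write_of_ne _ _ _ _ (by omega), write_of_ne _ _ _ _ (by omega),
      write_of_ne _ _ _ _ (by omega)]
    exact h.bidding

/-- Compute the maximal price and the number of rounds. -/
def boundProgram : Program :=
  .seq (.assign 6 (.const 0) (.const 0) (.const 1)) (.seq
    (.for 12 (.var 0) (.assign 6 (.const 0) (.const 0) (.add (.var 6) (.var 0))))
    (.for 12 (.var 6) (.assign 7 (.const 0) (.const 0) (.add (.var 7) (.var 6)))))

/-- The machine has no multiplication, so both products are computed by repeated addition. -/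
theorem runs_boundProgram {I : Instance} {X : ℕ → ℕ → ℕ} {σ : Memory} (hI : HasInput I σ)
    (hF : Fresh 6 σ) (hK : PartialFixed I X I.n 0 (σ 5)) :
    Runs boundProgram σ (1 + (I.n * (1 + 2) + 2 + ((I.n * I.n + 1) * (1 + 2) + 2)))
      (InAuction I X 0 0 0 0 0) := by
  refine Runs.seq (Runs.assign (Runs.seq ((Runs.for (fun i τ => HasInput I τ ∧ Fresh 7 τ ∧
    PartialFixed I X I.n 0 (τ 5) ∧ τ 6 0 0 = i * I.n + 1) (fun i τ h => h.1.eval_size) ?_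
    ⟨hI.write (by norm_num) _ _ _, (hF.mono (by norm_num)).write (by norm_num) _ _ _,
      by simpa using hK, by simp [Expr.eval]⟩ ?_).mono le_rfl ?_)))
  · rintro i τ x ⟨h1, h2, h3⟩
    exact ⟨h1.write (by norm_num) _ _ _, h2.write (by norm_num) _ _ _, by simpa using h3⟩
  · rintro i hi τ ⟨h1, h2, h3, h4⟩ h5
    refine Runs.assign ⟨by simpa using h5, h1.write (by norm_num) _ _ _,
      h2.write (by norm_num) _ _ _, by simpa using h3, ?_⟩
    simp [Expr.eval, h4, h1.size]
    ring
  · rintro τ ⟨h1, h2, h3, h4⟩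
    refine (Runs.for (e := .var 6) (N := I.n * I.n + 1) (fun i τ => HasInput I τ ∧ Fresh 8 τ ∧
      PartialFixed I X I.n 0 (τ 5) ∧ τ 6 0 0 = I.n * I.n + 1 ∧ τ 7 0 0 = i * (I.n * I.n + 1))
      (fun i τ h => h.2.2.2.1) ?_ ⟨h1, h2.mono (by norm_num), h3, h4, ?_⟩ ?_).mono le_rfl ?_
    · rintro i τ x ⟨h1, h2, h3⟩
      exact ⟨h1.write (by norm_num) _ _ _, h2.write (by norm_num) _ _ _, by simpa using h3⟩
    · rw [h2 7 le_rfl (by norm_num)]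
      simp
    · clear h1 h2 h3 h4 τ
      rintro i hi τ ⟨h1, h2, h3, h4, h5⟩ h6
      refine Runs.assign ⟨by simpa using h6, h1.write (by norm_num) _ _ _,
        h2.write (by norm_num) _ _ _, by simpa using h3, by simpa using h4, ?_⟩
      simp [Expr.eval, h4, h5]
      ring
    · clear h1 h2 h3 h4 τ
      rintro τ ⟨h1, h2, h3, h4, h5⟩
      exact ⟨h1, h4, h5, h2.mono (by norm_num), .init (.init h3.iff (h2 8 le_rfl (by norm_num))
        (h2 9 (by norm_num) (by norm_num)))⟩

/-- The vertex given by the scalar `13` acquires the pair given by the scalars `15` and `16`, if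
it is not kept, provides this pair, and the price is at most the scalar `14`. -/
def bidProgram : Program :=
  .when (.sub (.const 1) (.next 5 13)) (.when (.add (.entry 1 15 13) (.entry 2 15 13))
    (.when (.add (.entry 1 13 16) (.entry 2 13 16))
      (.when (.sub (.add (.var 14) (.const 1)) (.entry 8 15 16))
        (.seq (.assign 5 (.entry 9 15 16) (.const 0) (.const 0))
          (.seq (.assign 5 (.add (.var 13) (.const 1)) (.const 0) (.const 1))
            (.seq (.assign 8 (.var 15) (.var 16) (.add (.entry 8 15 16) (.const 1)))
              (.assign 9 (.var 15) (.var 16) (.add (.var 13) (.const 1)))))))))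

theorem runs_bidProgram {I : Instance} {X : ℕ → ℕ → ℕ} {r v l x y : ℕ} {σ : Memory}
    (h : InAuction I X r v l x y σ) (hv : v < I.n) (hl : l < I.maxPrice) (hx : x < I.n)
    (hy : y < I.n) (h12 : σ 12 0 0 = r) (h13 : σ 13 0 0 = v) (h14 : σ 14 0 0 = l)
    (h15 : σ 15 0 0 = x) (h16 : σ 16 0 0 = y) :
    Runs bidProgram σ 12 fun τ => τ 16 0 0 = y ∧ InAuction I X r v l x (y + 1) τ ∧
      τ 12 0 0 = r ∧ τ 13 0 0 = v ∧ τ 14 0 0 = l ∧ τ 15 0 0 = x := by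
  have e1 := h.input 1 (by norm_num)
  have e2 := h.input 2 (by norm_num)
  have hskip : (σ 5 (v + 1) 0 = 0 → I.Prov v x y → l + 1 ≤ σ 8 x y) →
      σ 16 0 0 = y ∧ InAuction I X r v l x (y + 1) σ ∧
      σ 12 0 0 = r ∧ σ 13 0 0 = v ∧ σ 14 0 0 = l ∧ σ 15 0 0 = x := fun hs =>
    ⟨h16, ⟨h.input, h.price, h.rounds, h.fresh, h.bidding.skip hs⟩, h12, h13, h14, h15⟩
  refine Runs.when (fun t1 => Runs.when (fun t2 => Runs.when (fun t3 => Runs.when (fun t4 =>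
    Runs.seq (U := 3) (Runs.assign (Runs.seq (U := 2) (Runs.assign (Runs.seq (U := 1)
      (Runs.assign (Runs.assign ?_)))))))
    fun t4 => hskip fun _ _ => ?_) fun t3 => hskip fun _ hp => absurd ?_ hp.2)
    fun t2 => hskip fun _ hp => absurd ?_ hp.1) fun t1 => hskip fun hK => absurd hK ?_
  · simp only [Expr.eval, h13, h14, h15, h16, e1, e2] at t1 t2 t3 t4 ⊢
    have hb := h.bidding.push hv hx hy hl (by omega) ⟨t2, t3⟩ (by omega)
    refine ⟨by simpa using h16, ⟨?_, by simpa using h.price, by simpa using h.rounds, ?_, ?_⟩,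
      by simpa using h12, by simpa using h13, by simpa using h14, by simpa using h15⟩
    · exact (((h.input.write (by norm_num) _ _ _).write (by norm_num) _ _ _).write
        (by norm_num) _ _ _).write (by norm_num) _ _ _
    · exact (((h.fresh.write (by norm_num) _ _ _).write (by norm_num) _ _ _).write
        (by norm_num) _ _ _).write (by norm_num) _ _ _
    · simpa [h13, h15, h16] using hb
  · simp only [Expr.eval, h14, h15, h16] at t4
    omega
  · simpa only [Expr.eval, h13, h16, e1, e2] using t3
  · simpa only [Expr.eval, h13, h15, e1, e2] using t2
  · simp only [Expr.eval, h13] at t1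
    omega

/-- The auction. -/
def auctionProgram : Program :=
  .for 12 (.var 7) (.for 13 (.var 0) (.for 14 (.var 6) (.for 15 (.var 0) (.for 16 (.var 0)
    bidProgram))))

theorem runs_auctionProgram {I : Instance} {X : ℕ → ℕ → ℕ} {σ : Memory}
    (h : InAuction I X 0 0 0 0 0 σ) :
    Runs auctionProgram σ ((I.maxPrice * I.maxPrice) * (I.n * (I.maxPrice * (I.n * (I.n * (12 + 2)
      + 2 + 2) + 2 + 2) + 2 + 2) + 2 + 2) + 2)
      (InAuction I X (I.maxPrice * I.maxPrice) 0 0 0 0) := by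
  refine Runs.for (e := .var 7) (fun r τ => InAuction I X r 0 0 0 0 τ) (fun r τ h => h.rounds)
    (fun r τ c h => h.write (by norm_num) _ _ _) h ?_
  clear h σ
  intro r hr τ h h12
  refine (Runs.for (fun v τ => InAuction I X r v 0 0 0 τ ∧ τ 12 0 0 = r)
    (fun v τ h => h.1.input.eval_size)
    (fun v τ c h => ⟨h.1.write (by norm_num) _ _ _, by simpa using h.2⟩) ⟨h, h12⟩ ?_).mono le_rfl
    fun τ h => ⟨h.2, h.1.input, h.1.price, h.1.rounds, h.1.fresh, h.1.bidding.next_round⟩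
  clear h h12 τ
  rintro v hv τ ⟨h, h12⟩ h13
  refine (Runs.for (e := .var 6) (fun l τ => InAuction I X r v l 0 0 τ ∧ τ 12 0 0 = r ∧ τ 13 0 0 = v)
    (fun v τ h => h.1.price)
    (fun v τ c h => ⟨h.1.write (by norm_num) _ _ _, by simpa using h.2⟩) ⟨h, h12, h13⟩ ?_).mono
    le_rfl fun τ h => ⟨h.2.2, ⟨h.1.input, h.1.price, h.1.rounds, h.1.fresh,
      h.1.bidding.next_vertex⟩, h.2.1⟩
  clear h h12 h13 τ
  rintro l hl τ ⟨h, h12, h13⟩ h14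
  refine (Runs.for (fun x τ => InAuction I X r v l x 0 τ ∧ τ 12 0 0 = r ∧ τ 13 0 0 = v ∧
    τ 14 0 0 = l) (fun v τ h => h.1.input.eval_size)
    (fun v τ c h => ⟨h.1.write (by norm_num) _ _ _, by simpa using h.2⟩)
    ⟨h, h12, h13, h14⟩ ?_).mono le_rfl fun τ h => ⟨h.2.2.2, ⟨h.1.input, h.1.price, h.1.rounds,
      h.1.fresh, h.1.bidding.next_price I.prov_lt⟩, h.2.1, h.2.2.1⟩
  clear h h12 h13 h14 τ
  rintro x hx τ ⟨h, h12, h13, h14⟩ h15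
  refine (Runs.for (fun y τ => InAuction I X r v l x y τ ∧ τ 12 0 0 = r ∧ τ 13 0 0 = v ∧
    τ 14 0 0 = l ∧ τ 15 0 0 = x) (fun v τ h => h.1.input.eval_size)
    (fun v τ c h => ⟨h.1.write (by norm_num) _ _ _, by simpa using h.2⟩)
    ⟨h, h12, h13, h14, h15⟩ ?_).mono le_rfl fun τ h => ⟨h.2.2.2.2, ⟨h.1.input, h.1.price,
      h.1.rounds, h.1.fresh, h.1.bidding.next_row I.prov_lt⟩, h.2.1, h.2.2.1, h.2.2.2.1⟩
  clear h h12 h13 h14 h15 τ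
  rintro y hy τ ⟨h, h12, h13, h14, h15⟩ h16
  exact runs_bidProgram h hv hl hx hy h12 h13 h14 h15 h16

/-! ### The output -/

/-- The first `c` entries of `l` are the vertices below `v` that are kept, in increasing order. -/
structure Listing (K : ℕ → ℕ → ℕ) (v c : ℕ) (l : ℕ → ℕ → ℕ) : Prop where
  mem : ∀ i < c, l i 0 < v ∧ K (l i 0 + 1) 0 ≠ 0
  lt : ∀ i j, i < j → j < c → l i 0 < l j 0
  surj : ∀ u < v, K (u + 1) 0 ≠ 0 → ∃ i < c, l i 0 = u

theorem Listing.skip {K l : ℕ → ℕ → ℕ} {v c : ℕ} (h : Listing K v c l)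
    (hK : K (v + 1) 0 = 0) : Listing K (v + 1) c l := by
  refine ⟨fun i hi => ⟨(h.mem i hi).1.trans (Nat.lt_succ_self v), (h.mem i hi).2⟩, h.lt,
    fun u hu hu' => ?_⟩
  by_cases he : u = v
  · exact absurd hK (he ▸ hu')
  · exact h.surj u (by omega) hu'

theorem Listing.push {K l : ℕ → ℕ → ℕ} {v c : ℕ} (h : Listing K v c l)
    (hK : K (v + 1) 0 ≠ 0) : Listing K (v + 1) (c + 1) (upd l c 0 v) := by
  have hl : ∀ i < c, upd l c 0 v i 0 = l i 0 := fun i hi => by simp [upd_apply, hi.ne]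
  refine ⟨fun i hi => ?_, fun i j hij hj => ?_, fun u hu hu' => ?_⟩
  · by_cases he : i = c
    · simp [he, hK]
    · have hi' : i < c := by omega
      rw [hl i hi']
      exact ⟨(h.mem i hi').1.trans (Nat.lt_succ_self v), (h.mem i hi').2⟩
  · rw [hl i (by omega)]
    by_cases he : j = c
    · rw [he, upd_self]
      exact (h.mem i (by omega)).1
    · rw [hl j (by omega)]
      exact h.lt i j hij (by omega)
  · by_cases he : u = v
    · exact ⟨c, by omega, by simp [he]⟩
    · obtain ⟨i, hi, hi'⟩ := h.surj u (by omega) hu'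
      exact ⟨i, by omega, by rw [hl i hi, hi']⟩

/-- This is what makes copying in place safe. -/
theorem Listing.le {K l : ℕ → ℕ → ℕ} {v c : ℕ} (h : Listing K v c l) : ∀ i < c, i ≤ l i 0 := by
  intro i
  induction i with
  | zero => simp
  | succ i ih =>
    intro hi
    have h1 := ih (by omega)
    have h2 := h.lt i (i + 1) (by omega) hi
    omega

/-- The matrix `e` is being replaced in place by the submatrix given by the first `c` entries of
`l`; the entries before `(i, j)` are done. -/
structure Copying (e l : ℕ → ℕ → ℕ) (c i j : ℕ) (f : ℕ → ℕ → ℕ) : Prop where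
  done : ∀ i' j', i' < c → j' < c → i' < i ∨ i' = i ∧ j' < j → f i' j' = e (l i' 0) (l j' 0)
  rest : ∀ i' j', i < i' ∨ i' = i ∧ j ≤ j' → f i' j' = e i' j'

theorem Copying.row {e l f : ℕ → ℕ → ℕ} {c i : ℕ} (h : Copying e l c i c f) :
    Copying e l c (i + 1) 0 f :=
  ⟨fun i' j' hi hj _ => h.done i' j' hi hj (by omega), fun i' j' _ => h.rest i' j' (by omega)⟩

/-- The entry that is read does not precede `(i, j)` lexicographically, so it has not been
overwritten yet. -/
theorem Copying.step {e l f : ℕ → ℕ → ℕ} {c i j : ℕ} (h : Copying e l c i j f)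
    (hi : i ≤ l i 0) (hj : j ≤ l j 0) :
    Copying e l c i (j + 1) (upd f i j (f (l i 0) (l j 0))) := by
  refine ⟨fun i' j' hi' hj' hlt => ?_, fun i' j' hle => ?_⟩
  · by_cases he : i' = i ∧ j' = j
    · obtain ⟨rfl, rfl⟩ := he
      rw [upd_self]
      exact h.rest _ _ (by omega)
    · rw [upd_apply, if_neg he]
      exact h.done i' j' hi' hj' (by omega)
  · rw [upd_apply, if_neg (by omega)]
    exact h.rest i' j' (by omega)

/-- List the kept vertices. -/
def listProgram : Program :=
  .for 12 (.var 0) (.when (.next 5 12)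
    (.seq (.assign 10 (.var 11) (.const 0) (.var 12))
      (.assign 11 (.const 0) (.const 0) (.add (.var 11) (.const 1)))))

theorem runs_listProgram {I : Instance} {K : ℕ → ℕ → ℕ} {σ : Memory} (hI : HasInput I σ)
    (hF : Fresh 10 σ) (hK : σ 5 = K) :
    Runs listProgram σ (I.n * (4 + 2) + 2) fun τ =>
      HasInput I τ ∧ Listing K I.n (τ 11 0 0) (τ 10) := by
  refine (Runs.for (fun v τ => HasInput I τ ∧ Listing K v (τ 11 0 0) (τ 10) ∧ τ 5 = K)
    (fun v τ h => h.1.eval_size)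
    (fun v τ c h => ⟨h.1.write (by norm_num) _ _ _, by simpa using h.2⟩) ⟨hI, ?_, hK⟩ ?_).mono
    le_rfl fun τ h => ⟨h.1, h.2.1⟩
  · rw [hF 11 (by norm_num) (by norm_num)]
    exact ⟨by simp, by simp, by simp⟩
  rintro v hv τ ⟨h1, h2, h3⟩ h4
  refine Runs.when (fun ht => Runs.seq (Runs.assign (Runs.assign ?_))) fun ht => ?_
  all_goals simp only [Expr.eval, h3, h4] at ht ⊢
  · exact ⟨by simpa using h4, (h1.write (by norm_num) _ _ _).write (by norm_num) _ _ _,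
      by simpa using h2.push ht, by simpa using h3⟩
  · exact ⟨trivial, h1, h2.skip ht, trivial⟩

/-- Replace the three matrices by the submatrices given by the list, and the number of vertices by
its length. -/
def copyProgram : Program :=
  .seq (.for 12 (.var 11) (.for 13 (.var 11)
    (.seq (.assign 1 (.var 12) (.var 13) (.get 1 (.at 10 12) (.at 10 13)))
      (.seq (.assign 2 (.var 12) (.var 13) (.get 2 (.at 10 12) (.at 10 13)))
        (.assign 3 (.var 12) (.var 13) (.get 3 (.at 10 12) (.at 10 13)))))))
    (.assign 0 (.const 0) (.const 0) (.var 11))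

/-- The invariant of `copyProgram`. -/
structure InCopy (I : Instance) (l : ℕ → ℕ → ℕ) (c i j : ℕ) (σ : Memory) : Prop where
  one : Copying (I.encode 1) l c i j (σ 1)
  two : Copying (I.encode 2) l c i j (σ 2)
  three : Copying (I.encode 3) l c i j (σ 3)
  list : σ 10 = l
  length : σ 11 0 0 = c

theorem InCopy.write {I : Instance} {l : ℕ → ℕ → ℕ} {c i j : ℕ} {σ : Memory}
    (h : InCopy I l c i j σ) {a : ℕ} (ha : 12 ≤ a ∨ a = 0) (i' j' x : ℕ) :
    InCopy I l c i j (σ.write a i' j' x) := by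
  obtain ⟨h1, h2, h3, h4, h5⟩ := h
  constructor <;> rwa [write_of_ne _ _ _ _ (by omega)]

theorem runs_copyProgram {I : Instance} {K l : ℕ → ℕ → ℕ} {v c : ℕ} {σ : Memory}
    (hI : HasInput I σ) (hl : Listing K v c l) (h10 : σ 10 = l) (h11 : σ 11 0 0 = c) :
    Runs copyProgram σ (c * (c * (3 + 2) + 2 + 2) + 2 + 1) fun τ =>
      τ 0 0 0 = c ∧ InCopy I l c c 0 τ := by
  have hinit : ∀ e, Copying e l c 0 0 e := fun e =>
    ⟨fun i j _ _ h => by omega, fun i j _ => rfl⟩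
  refine Runs.seq ((Runs.for (e := .var 11) (fun i τ => InCopy I l c i 0 τ) (fun i τ h => h.length)
    (fun i τ x h => h.write (by norm_num) _ _ _) ?_ ?_).mono le_rfl ?_)
  · refine ⟨?_, ?_, ?_, h10, h11⟩ <;> rw [hI _ (by norm_num)] <;> exact hinit _
  · clear hI h10 h11 σ
    rintro i hi τ h h12
    refine (Runs.for (e := .var 11) (fun j τ => InCopy I l c i j τ ∧ τ 12 0 0 = i)
      (fun i τ h => h.1.length)
      (fun i τ x h => ⟨h.1.write (by norm_num) _ _ _, by simpa using h.2⟩) ⟨h, h12⟩ ?_).mono le_rfl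
      fun τ h => ⟨h.2, h.1.one.row, h.1.two.row, h.1.three.row, h.1.list, h.1.length⟩
    clear h h12 τ
    rintro j hj τ ⟨h, h12⟩ h13
    refine Runs.seq (U := 2) (Runs.assign (Runs.seq (U := 1) (Runs.assign (Runs.assign ?_))))
    have h1 := h.one.step (hl.le i hi) (hl.le j hj)
    have h2 := h.two.step (hl.le i hi) (hl.le j hj)
    have h3 := h.three.step (hl.le i hi) (hl.le j hj)
    simp only [Expr.eval]
    refine ⟨by simpa using h13, ⟨?_, ?_, ?_, by simpa using h.list, by simpa using h.length⟩,
      by simpa using h12⟩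
    · simpa [h12, h13, h.list] using h1
    · simpa [h12, h13, h.list] using h2
    · simpa [h12, h13, h.list] using h3
  · intro τ h
    refine Runs.assign ⟨?_, h.write (by norm_num) _ _ _⟩
    simpa [Expr.eval] using h.length

/-! ### Assembling the kernelization algorithm -/

theorem Listing.le_length {K l : ℕ → ℕ → ℕ} {v c : ℕ} (h : Listing K v c l) : c ≤ v := by
  rcases c with _ | c
  · exact Nat.zero_le _
  · have h1 := h.le c (by omega)
    have h2 := (h.mem c (by omega)).1
    omega

theorem exists_kernel {I : Instance} {X K h H l : ℕ → ℕ → ℕ} {c : ℕ} {σ : Memory}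
    (hX : ∀ u v, I.Link u v → X u 0 ≠ 0 ∨ X v 0 ≠ 0) (hcard : (I.marked X).card ≤ 2 * I.vc)
    (a : Auction I.n (I.n * I.n + 1) I.Prov (I.Fixed X) K h H)
    (hset : Settled (I.n * I.n + 1) I.Prov I.n K h) (hl : Listing K I.n c l)
    (h0 : σ 0 0 0 = c) (hσ : InCopy I l c c 0 σ) :
    ∃ I', Represents σ I' ∧ I.IsKernel I' := by
  have hinj : Function.Injective fun i : Fin c => (⟨l i 0, (hl.mem i i.2).1⟩ : Fin I.n) := by
    intro i j hij
    have hij' : l i 0 = l j 0 := congrArg Fin.val hij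
    rcases lt_trichotomy (i : ℕ) j with hlt | heq | hlt
    · exact absurd hij' (hl.lt i j hlt j.2).ne
    · exact Fin.ext heq
    · exact absurd hij' (hl.lt j i hlt i.2).ne'
  refine ⟨I.comap ⟨_, hinj⟩, ⟨h0, fun b hb i hi j hj => ?_⟩,
    I.isKernel_comap hX hcard a hset _ fun v => ⟨?_, fun hv => ?_⟩⟩
  · refine Eq.trans ?_ (I.encode_comap ⟨_, hinj⟩ hb ⟨i, hi⟩ ⟨j, hj⟩).symm
    rcases hb with rfl | rfl | rfl
    · exact hσ.one.done i j hi hj (Or.inl hi)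
    · exact hσ.two.done i j hi hj (Or.inl hi)
    · exact hσ.three.done i j hi hj (Or.inl hi)
  · rintro ⟨i, rfl⟩
    exact (hl.mem i i.2).2
  · obtain ⟨i, hi, hi'⟩ := hl.surj v v.2 hv
    exact ⟨⟨i, hi⟩, Fin.ext hi'⟩

/-- The kernelization algorithm. -/
def kernelProgram : Program :=
  .seq coverProgram (.seq fixProgram (.seq boundProgram (.seq auctionProgram
    (.seq listProgram copyProgram))))

open Polynomial in
theorem exists_runs_kernelProgram : ∃ p : Polynomial ℕ, ∀ I : Instance,
    Runs kernelProgram I.encode (p.eval I.n) fun σ => ∃ I', Represents σ I' ∧ I.IsKernel I' := by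
  refine ⟨(X * (X * (8 + 2) + 2 + 2) + 2) + ((X * (X * (4 + 2) + 2 + 3 + 2) + 2) +
    ((1 + (X * (1 + 2) + 2 + ((X * X + 1) * (1 + 2) + 2))) +
    ((((X * X + 1) * (X * X + 1)) * (X * ((X * X + 1) * (X * (X * (12 + 2)
      + 2 + 2) + 2 + 2) + 2 + 2) + 2 + 2) + 2) + ((X * (4 + 2) + 2) +
      (X * (X * (3 + 2) + 2 + 2) + 2 + 1))))), fun I => ?_⟩
  simp only [eval_add, eval_mul, eval_X, eval_one, eval_ofNat]
  obtain ⟨S, hS, hcov⟩ := I.exists_cover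
  refine Runs.seq ((runs_coverProgram hcov (hasInput_encode I) (fresh_encode I)).mono le_rfl ?_)
  rintro σ₁ ⟨hI₁, hF₁, hX⟩
  refine Runs.seq ((runs_fixProgram hI₁ hF₁ rfl).mono le_rfl ?_)
  rintro σ₂ ⟨hI₂, hF₂, hK⟩
  refine Runs.seq ((runs_boundProgram hI₂ hF₂ hK).mono le_rfl fun σ₃ h₃ => ?_)
  refine Runs.seq ((runs_auctionProgram h₃).mono le_rfl fun σ₄ h₄ => ?_)
  refine Runs.seq ((runs_listProgram h₄.input h₄.fresh rfl).mono le_rfl ?_)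
  rintro σ₅ ⟨hI₅, hl⟩
  have hc := hl.le_length
  -- The copying time depends on the number of kept vertices, which is replaced by the upper bound
  -- `I.n`.
  refine (runs_copyProgram hI₅ hl rfl rfl).mono (by gcongr) fun σ₆ h₆ =>
    exists_kernel (fun u v h => hX.cover u v h (Or.inl h.lt.1)) ?_ h₄.bidding.auction
      h₄.bidding.settled hl h₆.1 h₆.2
  -- The marked vertices number at most `2 * (I.marked (σ₁ 4) ∩ S).card ≤ 2 * S.card`, where `S` is
  -- a minimum vertex cover.
  have h1 := hX.card
  have h2 := Finset.card_le_card (Finset.inter_subset_right (s₁ := I.marked (σ₁ 4)) (s₂ := S))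
  omega

end SteinerOrientation

theorem theorem7 :
    ∃ (C : ℕ) (f : SteinerOrientation.Instance → SteinerOrientation.Instance),
      SteinerOrientation.PolyTimeComputable f ∧
      ∀ I : SteinerOrientation.Instance,
        (I.IsYes ↔ (f I).IsYes) ∧
        (f I).n ≤ C * (I.vc ^ 2 + I.k) ∧
        (f I).k ≤ I.k := by
  obtain ⟨p, hp⟩ := SteinerOrientation.exists_runs_kernelProgram
  choose t σ ht he I' hrep hker using hp
  exact ⟨6, I', ⟨_, p, fun I => ⟨t I, σ I, ht I, he I, hrep I⟩⟩, hker⟩
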